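/- Let $n\ge 2$ be even, $k=n/2$, let $B$ be the open unit ball of $\mathbb{R}^n$ centred at the origin, and put $w_1(r)=\left(\ln\frac{\mathrm{e}}{r}\right)^{n/2}$ for $0<r<1$ and $c_n=\frac{\omega_{n-1}}{k}\binom{n-1}{k-1}$, where $\omega_{n-1}$ is the area of the unit sphere in $\mathbb{R}^n$. Let $\Phi^k_{0,\mathrm{rad}}(B)$ be the set of radially symmetric functions $u\in C^2(B)\cap C^0(\overline B)$ with $u=0$ on $\partial B$ and $S_j(D^2u)\ge 0$ in $B$ for $j=1,\dots,k$, where $S_j(D^2u)$ is the sum of all $j\times j$ principal minors of the Hessian matrix $D^2u$. For a radially symmetric $u$ on $B$ with profile $v$, $u(x)=v(|x|)$, where $v$ is locally absolutely continuous on $(0,1)$ and $\lim_{r\to1^-}v(r)=0$, set $$\|u\|_{\Phi,w_1}=\Big(c_n\int_0^1 r^{n-k}|v'(r)|^{k+1}w_1(r)\,\mathrm{d}r\Big)^{\frac1{k+1}}.$$ Let $\Phi^k_{0,\mathrm{rad}}(B,w_1)$ be the closure of $\{u\in\Phi^k_{0,\mathrm{rad}}(B):\|u\|_{\Phi,w_1}<\infty\}$,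 with respect to the norm $\|\cdot\|_{\Phi,w_1}$, in the space of all such radially symmetric $u$ with $\|u\|_{\Phi,w_1}<\infty$. Then: (a) For every $u\in\Phi^k_{0,\mathrm{rad}}(B,w_1)$, $$\int_B \mathrm{e}^{\mathrm{e}^{|u|^{\frac{n+2}{n}}}}\,\mathrm{d}x<\infty.$$ (b) Let $\Sigma_1=\{u\in\Phi^k_{0,\mathrm{rad}}(B,w_1):\|u\|_{\Phi,w_1}\le 1\}$. For every $a\in\mathbb{R}$, $$\sup_{u\in\Sigma_1}\int_B \mathrm{e}^{a\,\mathrm{e}^{c_n^{2/n}|u|^{\frac{n+2}{n}}}}\,\mathrm{d}x<\infty\iff a\le n.$$ -/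

import Mathlib

open Set Filter Topology MeasureTheory
open scoped ENNReal

noncomputable section

namespace KHessian

/-- `E n` is `ℝⁿ` with the Euclidean norm. -/
abbrev E (n : ℕ) : Type := EuclideanSpace ℝ (Fin n)

/-- The open unit ball of `ℝⁿ` centred at the origin. -/
def unitBall (n : ℕ) : Set (E n) := Metric.ball 0 1

/-- The Hessian matrix `D²u(x)`: its `(i, l)` entry is the second partial derivative of `u` at `x`
in the directions of the standard basis vectors `e_i` and `e_l`. -/
def hessian {n : ℕ} (u : E n → ℝ) (x : E n) : Matrix (Fin n) (Fin n) ℝ :=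
  Matrix.of fun i l =>
    fderiv ℝ (fderiv ℝ u) x (EuclideanSpace.single i 1) (EuclideanSpace.single l 1)

/-- The sum of all `j × j` principal minors of a square matrix. -/
def sumPrincipalMinors {n : ℕ} (j : ℕ) (A : Matrix (Fin n) (Fin n) ℝ) : ℝ :=
  ∑ s ∈ (Finset.univ : Finset (Fin n)).powersetCard j,
    (A.submatrix (Subtype.val : s → Fin n) (Subtype.val : s → Fin n)).det

/-- `Φᵏ(Ω)`, the `k`-admissible functions on `Ω`: `u ∈ C²(Ω) ∩ C⁰(closure Ω)` with
`S_j(D²u) ≥ 0` on `Ω` for `j = 1, …, k`.  (Functions are total; values outside `closure Ω` play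
no role.) -/
def Phi {n : ℕ} (k : ℕ) (Ω : Set (E n)) : Set (E n → ℝ) :=
  {u | ContDiffOn ℝ 2 u Ω ∧ ContinuousOn u (closure Ω) ∧
    ∀ j ∈ Finset.Icc 1 k, ∀ x ∈ Ω, 0 ≤ sumPrincipalMinors j (hessian u x)}

/-- `Φᵏ₀(Ω)`: the `k`-admissible functions that vanish on the boundary of `Ω`. -/
def PhiZero {n : ℕ} (k : ℕ) (Ω : Set (E n)) : Set (E n → ℝ) :=
  {u | u ∈ Phi k Ω ∧ ∀ x ∈ frontier Ω, u x = 0}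

/-- `u` is radially symmetric on the unit ball. -/
def IsRadial {n : ℕ} (u : E n → ℝ) : Prop :=
  ∀ x ∈ unitBall n, ∀ y ∈ unitBall n, ‖x‖ = ‖y‖ → u x = u y

/-- `Φᵏ_{0,rad}(B)`: the radially symmetric functions in `Φᵏ₀(B)`. -/
def PhiZeroRad (n k : ℕ) : Set (E n → ℝ) :=
  {u | u ∈ PhiZero k (unitBall n) ∧ IsRadial u}

/-- The radial profile `v` of a function `u`: for `u` radially symmetric on the unit ball,
`u x = v ‖x‖` for all `x` in the ball. -/
def profile {n : ℕ} [NeZero n] (u : E n → ℝ) (r : ℝ) : ℝ :=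
  u (r • EuclideanSpace.single (0 : Fin n) (1 : ℝ))

/-- `ω_{n-1}`, the area of the unit sphere of `ℝⁿ`. -/
def sphereArea (n : ℕ) : ℝ := (volume : Measure (E n)).toSphere.real univ

/-- The constant `c_n = (ω_{n-1} / k) * binom (n-1) (k-1)`. -/
def cConst (n k : ℕ) : ℝ := sphereArea n / k * ((n - 1).choose (k - 1) : ℝ)

/-- The weighted norm `‖u‖_{Φ,w} = (c_n ∫₀¹ r^{n-k} |v'(r)|^{k+1} w(r) dr)^{1/(k+1)}`, with values
in `[0,∞]`, where `v` is the radial profile of `u`. -/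
def wNorm {n : ℕ} [NeZero n] (k : ℕ) (w : ℝ → ℝ) (u : E n → ℝ) : ℝ≥0∞ :=
  (ENNReal.ofReal (cConst n k) *
    ∫⁻ r in Ioo (0 : ℝ) 1,
      ENNReal.ofReal (r ^ (n - k) * |deriv (profile u) r| ^ (k + 1) * w r)) ^
    (1 / ((k : ℝ) + 1))

/-- The ambient normed space in which the closure is taken: radially symmetric functions on the
unit ball whose profile is locally absolutely continuous on `(0,1)` and tends to `0` at `1`, and
whose weighted norm is finite. -/
def radialSobolev (n : ℕ) [NeZero n] (k : ℕ) (w : ℝ → ℝ) : Set (E n → ℝ) :=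
  {u | IsRadial u ∧
    (∀ a b : ℝ, 0 < a → a ≤ b → b < 1 → AbsolutelyContinuousOnInterval (profile u) a b) ∧
    Tendsto (profile u) (𝓝[<] 1) (𝓝 0) ∧ wNorm k w u < ∞}

/-- `Φᵏ_{0,rad}(B, w)`: the closure, for the weighted norm, of the set of functions in
`Φᵏ_{0,rad}(B)` whose weighted norm is finite. -/
def PhiZeroRadW (n : ℕ) [NeZero n] (k : ℕ) (w : ℝ → ℝ) : Set (E n → ℝ) :=
  {u | u ∈ radialSobolev n k w ∧
    ∀ ε : ℝ≥0∞, 0 < ε → ∃ φ ∈ PhiZeroRad n k, wNorm k w φ < ∞ ∧ wNorm k w (u - φ) < ε}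

/-- The weight `w₁(r) = (ln (e / r))^{n/2}`. -/
def wOne (n : ℕ) (r : ℝ) : ℝ := Real.log (Real.exp 1 / r) ^ ((n : ℝ) / 2)

end KHessian

end

namespace KHessian

/-! Write `T = 1 - log r`, `s = log T = loglog r`, `q = (k+1)/k = (n+2)/n`. Since `n = 2k`, the
substitution `r ↦ s` turns the weighted energy into `∫ |dv/ds|^(k+1) ds`. Hölder then gives `|v a -
v b| ≤ (Δs)^(k/(k+1)) J^(1/(k+1))`, with `J` the energy between the two points (`abs_sub_le`).

For (a), the energy near the origin is small, so `|v|^q ≤ C + s/2` (`exists_rpow_abs_le`). Hence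
`exp (|v|^q)` is at most a multiple of `√T`, which is integrable after another exponential.

For (b) with `a = n`, normalize `y = c^(1/(k+1)) |v|`, so that the deficit `G = T - exp (y^q)` is
nonnegative. The radial integral equals `e^n ∫ e^(-nG) dr/r`, so it suffices that each `{G ≤ l}` has
logarithmic length `O(l)`. A small deficit at one point means that nearly all the energy lies
between it and the boundary, leaving too little for the profile to keep pace with `s` further in.
Thus, apart from `T = O(l)`, the set lies in one interval of length `O(l)` (`sublevel_separation`,
`exists_deficit_sublevel_subset`).

For `a > n`, Moser-type functions `-c log (1 + ½ log ((1+δ)/(|x|²+δ)))` are admissible and have norm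
at most one for a suitable `c`. On the ball of radius `√δ = e^(-t)` the inner exponential is at
least `t - O(1)`, so the integral is at least a constant times `e^((a-n)t)`. -/

/-! ### Polar coordinates, and the iterated logarithm as radial variable. -/

theorem lintegral_fun_norm {F : Type*} [NormedAddCommGroup F] [NormedSpace ℝ F]
    [FiniteDimensional ℝ F] [Nontrivial F] [MeasurableSpace F] [BorelSpace F]
    (μ : Measure F) [μ.IsAddHaarMeasure] {f : ℝ → ℝ≥0∞} (hf : Measurable f) :
    ∫⁻ x, f ‖x‖ ∂μ = μ.toSphere univ *
      ∫⁻ r in Ioi (0 : ℝ), ENNReal.ofReal (r ^ (Module.finrank ℝ F - 1)) * f r := by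
  have hfm : Measurable fun x : Ioi (0 : ℝ) => f x := hf.comp measurable_subtype_coe
  calc
    ∫⁻ x, f ‖x‖ ∂μ = ∫⁻ x : ({(0)}ᶜ : Set F), f ‖x.1‖ ∂(μ.comap (↑)) := by
      rw [lintegral_subtype_comap (measurableSet_singleton _).compl fun x ↦ f (‖x‖),
        restrict_compl_singleton]
    _ = ∫⁻ x, f x.2 ∂μ.toSphere.prod (.volumeIoiPow (Module.finrank ℝ F - 1)) := by
      rw [← μ.measurePreserving_homeomorphUnitSphereProd.lintegral_comp_emb
        (Homeomorph.measurableEmbedding _)]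
      simp
    _ = μ.toSphere univ * ∫⁻ x : Ioi (0 : ℝ), f x ∂.volumeIoiPow (Module.finrank ℝ F - 1) := by
      rw [lintegral_prod (fun x : _ × Ioi (0 : ℝ) => f x.2) (hfm.comp measurable_snd).aemeasurable]
      simp [mul_comm]
    _ = _ := by
      rw [Measure.volumeIoiPow, lintegral_withDensity_eq_lintegral_mul _
        (by fun_prop) hfm]
      congr 1
      exact lintegral_subtype_comap measurableSet_Ioi
        fun r : ℝ => ENNReal.ofReal (r ^ (Module.finrank ℝ F - 1)) * f r

/-- The iterated logarithm `ln ln (e / r)`. -/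
noncomputable def loglog (r : ℝ) : ℝ := Real.log (1 - Real.log r)

theorem one_sub_log_pos {r : ℝ} (h0 : 0 < r) (h1 : r ≤ 1) : 1 ≤ 1 - Real.log r := by
  have := Real.log_nonpos h0.le h1
  linarith

theorem loglog_nonneg {r : ℝ} (h0 : 0 < r) (h1 : r ≤ 1) : 0 ≤ loglog r :=
  Real.log_nonneg (one_sub_log_pos h0 h1)

theorem exp_loglog {r : ℝ} (h0 : 0 < r) (h1 : r ≤ 1) : Real.exp (loglog r) = 1 - Real.log r :=
  Real.exp_log (by linarith [one_sub_log_pos h0 h1])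

theorem loglog_anti {a b : ℝ} (h0 : 0 < a) (hab : a ≤ b) (h1 : b ≤ 1) : loglog b ≤ loglog a := by
  apply Real.log_le_log (by linarith [one_sub_log_pos (h0.trans_le hab) h1])
  linarith [Real.log_le_log h0 hab]

theorem hasDerivAt_loglog {r : ℝ} (h0 : 0 < r) (h1 : r ≤ 1) :
    HasDerivAt loglog (-(1 / (r * (1 - Real.log r)))) r := by
  have hp := one_sub_log_pos h0 h1
  have h := ((Real.hasDerivAt_log h0.ne').const_sub 1).log (by linarith)
  convert! h using 1
  field_simp

theorem lintegral_weight {a b : ℝ} (h0 : 0 < a) (hab : a ≤ b) (h1 : b ≤ 1) :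
    ∫⁻ r in Ioo a b, ENNReal.ofReal (1 / (r * (1 - Real.log r))) =
      ENNReal.ofReal (loglog a - loglog b) := by
  have hpos : ∀ r ∈ Icc a b, 0 < r * (1 - Real.log r) := fun r hr =>
    mul_pos (h0.trans_le hr.1) (by linarith [one_sub_log_pos (h0.trans_le hr.1) (hr.2.trans h1)])
  have hcont : ContinuousOn (fun r => 1 / (r * (1 - Real.log r))) (Icc a b) := by
    apply ContinuousOn.div continuousOn_const _ (fun r hr => (hpos r hr).ne')
    apply continuousOn_id.mul (continuousOn_const.sub _)
    exact Real.continuousOn_log.mono fun r hr => (h0.trans_le hr.1).ne'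
  have hint : IntervalIntegrable (fun r => 1 / (r * (1 - Real.log r))) volume a b :=
    ContinuousOn.intervalIntegrable (by rwa [uIcc_of_le hab])
  rw [restrict_Ioo_eq_restrict_Ioc, ← ofReal_integral_eq_lintegral_ofReal hint.1
    ((ae_restrict_iff' measurableSet_Ioc).2 (.of_forall fun r hr =>
      (one_div_pos.2 (hpos r ⟨hr.1.le, hr.2⟩)).le)), ← intervalIntegral.integral_of_le hab]
  congr 1
  have := intervalIntegral.integral_eq_sub_of_hasDerivAt (f := fun r => -loglog r)
    (f' := fun r => 1 / (r * (1 - Real.log r))) (a := a) (b := b) (fun r hr => by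
      rw [uIcc_of_le hab] at hr
      simpa using! (hasDerivAt_loglog (h0.trans_le hr.1) (hr.2.trans h1)).neg) hint
  rw [this]; ring

/-! ### The energy and Hölder's inequality. -/

/-- The energy density `r^k |v'|^{k+1} (ln (e / r))^k`. -/
noncomputable def energyDensity (k : ℕ) (v : ℝ → ℝ) (r : ℝ) : ℝ≥0∞ :=
  ENNReal.ofReal (r ^ k * |deriv v r| ^ (k + 1) * (1 - Real.log r) ^ k)

/-- The energy of `v` on `(a, b)`. -/
noncomputable def energy (k : ℕ) (v : ℝ → ℝ) (a b : ℝ) : ℝ≥0∞ :=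
  ∫⁻ r in Ioo a b, energyDensity k v r

theorem ofReal_abs_sub_le {k : ℕ} (hk : 0 < k) {v : ℝ → ℝ} {a b : ℝ} (h0 : 0 < a) (hab : a ≤ b)
    (h1 : b ≤ 1) (hv : AbsolutelyContinuousOnInterval v a b) :
    ENNReal.ofReal |v a - v b| ≤
      ENNReal.ofReal (loglog a - loglog b) ^ ((k : ℝ) / (k + 1)) *
        energy k v a b ^ (1 / ((k : ℝ) + 1)) := by
  have hk' : (0 : ℝ) < k := by exact_mod_cast hk
  have hconj : Real.HolderConjugate (((k : ℝ) + 1) / k) ((k : ℝ) + 1) := by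
    rw [Real.holderConjugate_iff]
    refine ⟨by rw [lt_div_iff₀ hk']; linarith, by field_simp⟩
  -- The factors satisfy `g * f = |v'|`; `g` to the power `(k+1)/k` is the density of `-d loglog`,
  -- and `f` to the power `k+1` is the energy density.
  set g : ℝ → ℝ≥0∞ := fun r => ENNReal.ofReal
    ((1 / (r * (1 - Real.log r))) ^ ((k : ℝ) / (k + 1))) with hg
  set f : ℝ → ℝ≥0∞ := fun r => ENNReal.ofReal
    ((r * (1 - Real.log r)) ^ ((k : ℝ) / (k + 1)) * |deriv v r|) with hf
  have hmd := measurable_deriv v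
  have hml := Real.measurable_log
  have hgm : Measurable g := by
    apply Measurable.ennreal_ofReal
    apply Measurable.pow_const
    exact (measurable_const.div (measurable_id.mul (measurable_const.sub hml)))
  have hfm : Measurable f := by
    apply Measurable.ennreal_ofReal
    exact ((measurable_id.mul (measurable_const.sub hml)).pow_const _).mul
      (continuous_abs.measurable.comp hmd)
  have hpos : ∀ r ∈ Ioo a b, 0 < r * (1 - Real.log r) := fun r hr =>
    mul_pos (h0.trans hr.1) (by linarith [one_sub_log_pos (h0.trans hr.1) (hr.2.le.trans h1)])
  have hgp : ∀ r ∈ Ioo a b, g r ^ (((k : ℝ) + 1) / k) =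
      ENNReal.ofReal (1 / (r * (1 - Real.log r))) := fun r hr => by
    have := one_div_pos.2 (hpos r hr)
    rw [hg]
    dsimp only
    rw [ENNReal.ofReal_rpow_of_nonneg (by positivity) (by positivity), ← Real.rpow_mul this.le]
    congr 1
    rw [show (k : ℝ) / (k + 1) * ((k + 1) / k) = 1 by field_simp, Real.rpow_one]
  have hfp : ∀ r ∈ Ioo a b, f r ^ ((k : ℝ) + 1) = energyDensity k v r := fun r hr => by
    have := hpos r hr
    rw [hf]
    dsimp only
    rw [ENNReal.ofReal_rpow_of_nonneg (by positivity) (by positivity),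
      Real.mul_rpow (by positivity) (by positivity), ← Real.rpow_mul this.le, energyDensity]
    congr 1
    rw [show (k : ℝ) / (k + 1) * (k + 1) = (k : ℕ) by field_simp, Real.rpow_natCast,
      show ((k : ℝ) + 1) = ((k + 1 : ℕ) : ℝ) by push_cast; ring, Real.rpow_natCast, mul_pow]
    ring
  calc
    ENNReal.ofReal |v a - v b| = ENNReal.ofReal ‖∫ r in a..b, deriv v r‖ := by
      rw [hv.integral_deriv_eq_sub, Real.norm_eq_abs, abs_sub_comm]
    _ ≤ ∫⁻ r in Ioo a b, ENNReal.ofReal |deriv v r| := by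
      rw [intervalIntegral.integral_of_le hab, restrict_Ioo_eq_restrict_Ioc, ofReal_norm]
      refine (enorm_integral_le_lintegral_enorm _).trans_eq ?_
      refine lintegral_congr fun r => ?_
      rw [← ofReal_norm, Real.norm_eq_abs]
    _ = ∫⁻ r in Ioo a b, (g * f) r := by
      refine setLIntegral_congr_fun measurableSet_Ioo fun r hr => ?_
      have := hpos r hr
      simp only [hf, hg, Pi.mul_apply]
      rw [← ENNReal.ofReal_mul (by positivity), ← mul_assoc, ← Real.mul_rpow (by positivity)
        (by positivity), one_div_mul_cancel this.ne', Real.one_rpow, one_mul]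
    _ ≤ _ := ENNReal.lintegral_mul_le_Lp_mul_Lq _ hconj hgm.aemeasurable hfm.aemeasurable
    _ = _ := by
      rw [setLIntegral_congr_fun measurableSet_Ioo hgp,
        setLIntegral_congr_fun measurableSet_Ioo hfp, lintegral_weight h0 hab h1, energy, one_div_div]

theorem energy_add_energy_le (k : ℕ) (v : ℝ → ℝ) {a b c : ℝ} :
    energy k v a b + energy k v b c ≤ energy k v (min a b) (max b c) := by
  unfold energy
  rw [← lintegral_union measurableSet_Ioo]
  · apply lintegral_mono_set
    rintro r (hr | hr)
    · exact ⟨(min_le_left _ _).trans_lt hr.1, hr.2.trans_le (le_max_left _ _)⟩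
    · exact ⟨(min_le_right _ _).trans_lt hr.1, hr.2.trans_le (le_max_right _ _)⟩
  · rw [Set.disjoint_left]
    intro r hr hr'
    exact lt_asymm hr.2 hr'.1

/-- The two-point estimate behind the embedding. -/
theorem abs_sub_le {k : ℕ} (hk : 0 < k) {v : ℝ → ℝ} {a b : ℝ} (h0 : 0 < a) (hab : a ≤ b)
    (h1 : b ≤ 1) (hv : AbsolutelyContinuousOnInterval v a b) {J : ℝ} (hJ0 : 0 ≤ J)
    (hJ : energy k v a b ≤ ENNReal.ofReal J) :
    |v a - v b| ≤ (loglog a - loglog b) ^ ((k : ℝ) / (k + 1)) * J ^ (1 / ((k : ℝ) + 1)) := by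
  have hs : 0 ≤ loglog a - loglog b := sub_nonneg.2 (loglog_anti h0 hab h1)
  have h := ofReal_abs_sub_le hk h0 hab h1 hv
  have h2 : ENNReal.ofReal |v a - v b| ≤ ENNReal.ofReal ((loglog a - loglog b) ^ ((k : ℝ) / (k + 1))
      * J ^ (1 / ((k : ℝ) + 1))) := by
    rw [ENNReal.ofReal_mul (by positivity), ← ENNReal.ofReal_rpow_of_nonneg hs (by positivity),
      ← ENNReal.ofReal_rpow_of_nonneg hJ0 (by positivity)]
    refine h.trans ?_
    gcongr
  exact (ENNReal.ofReal_le_ofReal_iff (by positivity)).1 h2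

theorem abs_le_of_tendsto_zero {k : ℕ} (hk : 0 < k) {v : ℝ → ℝ} {a : ℝ} (h0 : 0 < a) (ha : a < 1)
    (hv : ∀ a b : ℝ, 0 < a → a ≤ b → b < 1 → AbsolutelyContinuousOnInterval v a b)
    (hlim : Tendsto v (𝓝[<] 1) (𝓝 0)) {J : ℝ} (hJ0 : 0 ≤ J)
    (hJ : energy k v a 1 ≤ ENNReal.ofReal J) :
    |v a| ≤ loglog a ^ ((k : ℝ) / (k + 1)) * J ^ (1 / ((k : ℝ) + 1)) := by
  have hlim' : Tendsto (fun b => |v a - v b|) (𝓝[<] 1) (𝓝 |v a|) := by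
    simpa using (hlim.const_sub (v a)).abs
  refine le_of_tendsto hlim' ?_
  filter_upwards [Ioo_mem_nhdsLT ha] with b hb
  have hb0 := h0.trans hb.1
  refine (abs_sub_le hk h0 hb.1.le hb.2.le (hv a b h0 hb.1.le hb.2) hJ0 ?_).trans ?_
  · refine le_trans ?_ hJ
    exact lintegral_mono_set (Ioo_subset_Ioo_right hb.2.le)
  · have hs : 0 ≤ loglog a - loglog b := sub_nonneg.2 (loglog_anti h0 hb.1.le hb.2.le)
    gcongr
    linarith [loglog_nonneg hb0 hb.2.le]


/-! ### Real inequalities: two points of small deficit are close. -/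

/-- Hölder for sums of two terms: weighted AM-GM applied to each term after division by the
right-hand side. -/
theorem rpow_mul_rpow_add_le {x z u w α β : ℝ} (hx : 0 < x) (hz : 0 ≤ z) (hu : 0 < u) (hw : 0 ≤ w)
    (hα : 0 ≤ α) (hβ : 0 ≤ β) (hαβ : α + β = 1) :
    x ^ α * u ^ β + z ^ α * w ^ β ≤ (x + z) ^ α * (u + w) ^ β := by
  have hxz : 0 < x + z := by linarith
  have huw : 0 < u + w := by linarith
  have h1 := Real.geom_mean_le_arith_mean2_weighted hα hβ (div_nonneg hx.le hxz.le)
    (div_nonneg hu.le huw.le) hαβ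
  have h2 := Real.geom_mean_le_arith_mean2_weighted hα hβ (div_nonneg hz hxz.le)
    (div_nonneg hw huw.le) hαβ
  rw [Real.div_rpow hx.le hxz.le, Real.div_rpow hu.le huw.le, div_mul_div_comm] at h1
  rw [Real.div_rpow hz hxz.le, Real.div_rpow hw huw.le, div_mul_div_comm] at h2
  have hP : 0 < (x + z) ^ α * (u + w) ^ β := by positivity
  have h3 : α * (x / (x + z)) + β * (u / (u + w)) + (α * (z / (x + z)) + β * (w / (u + w))) = 1 := by
    field_simp
    linear_combination (x + z) * (u + w) * hαβ
  have h4 := add_le_add h1 h2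
  rw [h3, ← add_div, div_le_one hP] at h4
  exact h4

/-- Here `j` is the energy spent before reaching `s`. The deficit `s - y₁^q` controls the remainder
`1 - j`, so over a further length `d` the quantity `y^q` gains only `d/2` plus a multiple of that
deficit. The slope `1/2 < 1` is what separates `y₂^q` from `s + d`. -/
theorem two_point_rpow_le {k : ℕ} (hk : 0 < k) {y₁ y₂ s d j : ℝ} (hy₁ : 0 ≤ y₁) (hy₂ : 0 ≤ y₂)
    (hs : 0 < s) (hd : 0 ≤ d) (hj0 : 0 ≤ j) (hj1 : j ≤ 1)
    (h₁ : y₁ ≤ s ^ ((k : ℝ) / (k + 1)) * j ^ (1 / ((k : ℝ) + 1)))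
    (h₂ : y₂ ≤ y₁ + d ^ ((k : ℝ) / (k + 1)) * (1 - j) ^ (1 / ((k : ℝ) + 1))) :
    y₂ ^ (((k : ℝ) + 1) / k) ≤
      s + d / 2 + 2 ^ k * (s - y₁ ^ (((k : ℝ) + 1) / k)) * (1 + d / (2 * s)) := by
  have hk' : (0 : ℝ) < k := by exact_mod_cast hk
  have hk1 : (1 : ℝ) ≤ k := by exact_mod_cast hk
  have e1 : (k : ℝ) / (k + 1) * ((k + 1) / k) = 1 := by field_simp
  have e2 : 1 / ((k : ℝ) + 1) * ((k + 1) / k) = 1 / k := by field_simp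
  have e3 : (k : ℝ) / (k + 1) + 1 / (k + 1) = 1 := by field_simp
  have hj' : 0 ≤ 1 - j := by linarith
  have hpw : ∀ {x u : ℝ}, 0 ≤ x → 0 ≤ u →
      (x ^ ((k : ℝ) / (k + 1)) * u ^ (1 / ((k : ℝ) + 1))) ^ (((k : ℝ) + 1) / k) =
        x * u ^ (1 / (k : ℝ)) := fun hx hu => by
    rw [Real.mul_rpow (by positivity) (by positivity), ← Real.rpow_mul hx, ← Real.rpow_mul hu,
      e1, e2, Real.rpow_one]
  set θ := j ^ (1 / (k : ℝ)) with hθ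
  have hθ0 : 0 ≤ θ := by positivity
  have hθk : θ ^ k = j := by
    rw [hθ, ← Real.rpow_natCast, ← Real.rpow_mul hj0, one_div_mul_cancel hk'.ne', Real.rpow_one]
  have hF : s * ((1 - j) / k) ≤ s - y₁ ^ (((k : ℝ) + 1) / k) := by
    have ha : y₁ ^ (((k : ℝ) + 1) / k) ≤ s * θ := by
      rw [hθ, ← hpw hs.le hj0]
      exact Real.rpow_le_rpow hy₁ h₁ (by positivity)
    -- Bernoulli for `θ^k = j`: `1 - θ^k ≤ k (1 - θ)`.
    have hb : (1 - j) / k ≤ 1 - θ := by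
      have := one_add_mul_le_pow (a := θ - 1) (by linarith) k
      rw [div_le_iff₀ hk', ← hθk]
      rw [add_sub_cancel] at this
      linarith
    nlinarith
  -- Halving `d` is paid for by the factor `2^k` on the energy: `d^α (1-j)^β = (d/2)^α (2^k
  -- (1-j))^β` for `α = k/(k+1)`, `β = 1/(k+1)`. The two-term Hölder inequality then merges the
  -- terms.
  have hy : y₂ ≤ (s + d / 2) ^ ((k : ℝ) / (k + 1)) *
      (1 + 2 ^ k * (1 - j)) ^ (1 / ((k : ℝ) + 1)) := by
    refine h₂.trans (le_trans ?_ (rpow_mul_rpow_add_le hs (div_nonneg hd zero_le_two) one_pos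
      (by positivity) (by positivity) (by positivity) e3))
    gcongr ?_ + ?_
    · refine h₁.trans ?_
      gcongr
    · refine le_of_eq ?_
      have : ((2 : ℝ) ^ k) ^ (1 / ((k : ℝ) + 1)) = 2 ^ ((k : ℝ) / (k + 1)) := by
        rw [← Real.rpow_natCast, ← Real.rpow_mul (by norm_num)]
        congr 1
        field_simp
      rw [Real.mul_rpow (by positivity) hj', this, ← mul_assoc, ← Real.mul_rpow (by positivity)
        (by positivity)]
      congr 2
      ring
  calc
    y₂ ^ (((k : ℝ) + 1) / k) ≤ (s + d / 2) * (1 + 2 ^ k * (1 - j)) ^ (1 / (k : ℝ)) := by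
      rw [← hpw (by positivity) (by positivity)]
      exact Real.rpow_le_rpow hy₂ hy (by positivity)
    _ ≤ (s + d / 2) * (1 + 1 / (k : ℝ) * (2 ^ k * (1 - j))) := by
      gcongr
      refine rpow_one_add_le_one_add_mul_self ?_ (by positivity) ?_
      · have : (0 : ℝ) ≤ 2 ^ k * (1 - j) := by positivity
        linarith
      · rw [div_le_one hk']; exact hk1
    _ = s + d / 2 + 2 ^ k * (s * ((1 - j) / k)) * (1 + d / (2 * s)) := by
      field_simp
    _ ≤ _ := by gcongr

/-- Converts a deficit `l` on the scale of `T` into a deficit `2l/T` on the scale of `log T`. -/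
theorem log_sub_two_mul_div_le {T l : ℝ} (hl : 0 ≤ l) (hT : 0 < T) (h : 2 * l ≤ T) :
    Real.log T - 2 * l / T ≤ Real.log (T - l) := by
  have hp : 0 < T - l := by linarith
  have h1 := Real.one_sub_inv_le_log_of_pos (div_pos hp hT)
  rw [Real.log_div hp.ne' hT.ne', inv_div] at h1
  have h2 : 1 - T / (T - l) = -(l / (T - l)) := by field_simp; ring
  have h3 : l / (T - l) ≤ 2 * l / T := by
    rw [div_le_div_iff₀ hp hT]
    nlinarith
  linarith

/-- With `d = log T₂ - log T₁` and `z = 2l/T₁`, both logarithmic deficits are at most `z`. Comparing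
`y₂^q ≥ s + d - z` with `two_point_rpow_le` gives `d = O(z)`, and `T₂ - T₁ = T₁ (e^d - 1)` is then
`O(T₁ z) = O(l)`. -/
theorem sublevel_separation {k : ℕ} (hk : 0 < k) {y₁ y₂ T₁ T₂ j l : ℝ} (hy₁ : 0 ≤ y₁)
    (hy₂ : 0 ≤ y₂) (hl : 1 ≤ l) (hT₁ : 8 * (1 + 2 ^ k) * l ≤ T₁) (hT : T₁ ≤ T₂)
    (hj0 : 0 ≤ j) (hj1 : j ≤ 1)
    (h₁ : y₁ ≤ Real.log T₁ ^ ((k : ℝ) / (k + 1)) * j ^ (1 / ((k : ℝ) + 1)))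
    (h₂ : y₂ ≤ y₁ + (Real.log T₂ - Real.log T₁) ^ ((k : ℝ) / (k + 1)) *
      (1 - j) ^ (1 / ((k : ℝ) + 1)))
    (hG₁ : T₁ - Real.exp (y₁ ^ (((k : ℝ) + 1) / k)) ≤ l)
    (hG₂ : T₂ - Real.exp (y₂ ^ (((k : ℝ) + 1) / k)) ≤ l) :
    T₂ - T₁ ≤ 2 * (8 * (1 + 2 ^ k)) * l := by
  have hK : (1 : ℝ) ≤ 2 ^ k := one_le_pow₀ (by norm_num)
  set K : ℝ := 2 ^ k with hKdef
  have hT8 : 16 * l ≤ T₁ := by nlinarith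
  have hT1 : 0 < T₁ := by linarith
  have hT2 : 0 < T₂ := by linarith
  have hs : 1 ≤ Real.log T₁ := by
    rw [Real.le_log_iff_exp_le hT1]
    linarith [Real.exp_one_lt_three]
  have hd : 0 ≤ Real.log T₂ - Real.log T₁ := sub_nonneg.2 (Real.log_le_log hT1 hT)
  have key := two_point_rpow_le hk hy₁ hy₂ (by linarith) hd hj0 hj1 h₁ h₂
  rw [← hKdef] at key
  have hF : ∀ {T y : ℝ}, T₁ ≤ T → T - Real.exp y ≤ l → Real.log T - y ≤ 2 * l / T₁ := by
    intro T y hTT hG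
    have hT0 : 0 < T := by linarith
    have h1 := log_sub_two_mul_div_le (by linarith : 0 ≤ l) hT0 (by linarith)
    have h2 : Real.log (T - l) ≤ y := by
      rw [Real.log_le_iff_le_exp (by linarith)]
      linarith
    have h3 : 2 * l / T ≤ 2 * l / T₁ := by gcongr
    linarith
  have hF1 := hF le_rfl hG₁
  have hF2 := hF hT hG₂
  set d := Real.log T₂ - Real.log T₁ with hddef
  set s := Real.log T₁ with hsdef
  set Y₁ := y₁ ^ (((k : ℝ) + 1) / k)
  set Y₂ := y₂ ^ (((k : ℝ) + 1) / k)
  set z := 2 * l / T₁ with hz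
  have hz0 : 0 ≤ z := by positivity
  -- The threshold on `T₁` is chosen for this bound: it absorbs `K z d/2` into `d/8`, and it gives
  -- `d ≤ 1`, where `e^d ≤ 1 + 2d`.
  have hKz : 8 * (1 + K) * z ≤ 2 := by
    rw [hz, ← mul_div_assoc, div_le_iff₀ hT1]
    linarith
  have hds : d / (2 * s) ≤ d / 2 := by gcongr; linarith
  have hds0 : 0 ≤ d / (2 * s) := by positivity
  have h5 : K * (s - Y₁) * (1 + d / (2 * s)) ≤ K * z * (1 + d / 2) := by gcongr
  have h6 : K * z * (d / 2) ≤ d / 8 := by nlinarith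
  have h7 : d ≤ 4 * (1 + K) * z := by nlinarith
  have h8 : d ≤ 1 := by linarith
  have h9 : Real.exp d ≤ 1 + 2 * d := by
    have := Real.abs_exp_sub_one_le (x := d) (by rw [abs_of_nonneg hd]; exact h8)
    rw [abs_of_nonneg hd] at this
    linarith [le_abs_self (Real.exp d - 1)]
  have h10 : T₂ = T₁ * Real.exp d := by
    rw [hddef, hsdef, Real.exp_sub, Real.exp_log hT2, Real.exp_log hT1]
    field_simp
  have h11 : T₁ * z = 2 * l := by rw [hz]; field_simp
  calc
    T₂ - T₁ = T₁ * (Real.exp d - 1) := by rw [h10]; ring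
    _ ≤ T₁ * (2 * (4 * (1 + K) * z)) := by gcongr; linarith
    _ = 8 * (1 + K) * (T₁ * z) := by ring
    _ = _ := by rw [h11]; ring


/-! ### Reduction to radial profiles. -/

theorem lintegral_unitBall_comp {n : ℕ} [NeZero n] {u : E n → ℝ} (hu : IsRadial u)
    (hv : ContinuousOn (profile u) (Ioo 0 1)) {Φ : ℝ → ℝ≥0∞} (hΦ : Measurable Φ) :
    ∫⁻ x in unitBall n, Φ (u x) = (volume : Measure (E n)).toSphere univ *
      ∫⁻ r in Ioo (0 : ℝ) 1, ENNReal.ofReal (r ^ (n - 1)) * Φ (profile u r) := by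
  classical
  -- The values of `u` off the ball are arbitrary, so the profile is cut off to make it measurable
  -- on all of `ℝ`.
  set w : ℝ → ℝ := (Ioo (0 : ℝ) 1).piecewise (profile u) 0 with hw
  have hwm : Measurable w := hv.measurable_piecewise continuousOn_const measurableSet_Ioo
  have hfm : Measurable ((Ioo (0 : ℝ) 1).indicator (Φ ∘ w)) :=
    (hΦ.comp hwm).indicator measurableSet_Ioo
  have hwr : ∀ r ∈ Ioo (0 : ℝ) 1, w r = profile u r := fun r hr => by
    rw [hw, piecewise_eq_of_mem _ _ _ hr]
  have h1 : ∫⁻ x in unitBall n, Φ (u x) =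
      ∫⁻ x : E n, (Ioo (0 : ℝ) 1).indicator (Φ ∘ w) ‖x‖ := by
    rw [← lintegral_indicator (by exact measurableSet_ball)]
    refine lintegral_congr_ae ?_
    have h0 : ∀ᵐ x : E n, x ≠ 0 := by simp [ae_iff]
    filter_upwards [h0] with x hx
    have hx0 : 0 < ‖x‖ := norm_pos_iff.2 hx
    by_cases hxb : x ∈ unitBall n
    · have hx1 : ‖x‖ < 1 := by simpa [unitBall] using hxb
      rw [indicator_of_mem hxb, indicator_of_mem (show ‖x‖ ∈ Ioo (0 : ℝ) 1 from ⟨hx0, hx1⟩),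
        Function.comp_apply, hwr _ ⟨hx0, hx1⟩, profile]
      congr 1
      have hnorm : ‖‖x‖ • EuclideanSpace.single (0 : Fin n) (1 : ℝ)‖ = ‖x‖ := by
        simp [norm_smul]
      refine hu x hxb _ ?_ hnorm.symm
      simpa [unitBall, hnorm] using hx1
    · have hx1 : ¬ ‖x‖ < 1 := by simpa [unitBall] using hxb
      rw [indicator_of_notMem hxb, indicator_of_notMem (fun h => hx1 h.2)]
  rw [h1, lintegral_fun_norm _ hfm, finrank_euclideanSpace_fin]
  congr 1
  have h2 : (fun r => ENNReal.ofReal (r ^ (n - 1)) * (Ioo (0 : ℝ) 1).indicator (Φ ∘ w) r) =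
      (Ioo (0 : ℝ) 1).indicator (fun r => ENNReal.ofReal (r ^ (n - 1)) * (Φ ∘ w) r) := by
    ext r
    by_cases hr : r ∈ Ioo (0 : ℝ) 1 <;> simp [hr]
  rw [h2, lintegral_indicator measurableSet_Ioo, Measure.restrict_restrict measurableSet_Ioo,
    inter_eq_left.2 Ioo_subset_Ioi_self]
  refine setLIntegral_congr_fun measurableSet_Ioo fun r hr => ?_
  simp only [Function.comp_apply, hwr r hr]

theorem continuousOn_of_locally_absolutelyContinuous {v : ℝ → ℝ}
    (hv : ∀ a b : ℝ, 0 < a → a ≤ b → b < 1 → AbsolutelyContinuousOnInterval v a b) :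
    ContinuousOn v (Ioo 0 1) := by
  intro r hr
  have h := (hv (r / 2) ((r + 1) / 2) (by linarith [hr.1]) (by linarith [hr.2])
    (by linarith [hr.2])).continuousOn
  rw [uIcc_of_le (by linarith [hr.2])] at h
  exact (h.continuousAt (Icc_mem_nhds (by linarith [hr.1]) (by linarith [hr.2]))).continuousWithinAt

theorem wOne_two_mul (k : ℕ) {r : ℝ} (h0 : 0 < r) : wOne (2 * k) r = (1 - Real.log r) ^ k := by
  rw [wOne, Real.log_div (Real.exp_pos 1).ne' h0.ne', Real.log_exp]
  push_cast
  rw [mul_div_cancel_left₀ _ two_ne_zero, Real.rpow_natCast]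

theorem wNorm_two_mul (k : ℕ) [NeZero (2 * k)] (u : E (2 * k) → ℝ) :
    wNorm k (wOne (2 * k)) u =
      (ENNReal.ofReal (cConst (2 * k) k) * energy k (profile u) 0 1) ^ (1 / ((k : ℝ) + 1)) := by
  rw [wNorm, energy]
  congr 2
  refine setLIntegral_congr_fun measurableSet_Ioo fun r hr => ?_
  rw [energyDensity, wOne_two_mul k hr.1, show 2 * k - k = k by omega]

theorem sphereArea_pos (n : ℕ) [NeZero n] : 0 < sphereArea n := by
  rw [sphereArea, Measure.toSphere_real_apply_univ, finrank_euclideanSpace_fin]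
  have hn : 0 < n := Nat.pos_of_ne_zero (NeZero.ne n)
  have : 0 < (volume : Measure (E n)).real (Metric.ball 0 1) :=
    ENNReal.toReal_pos (Metric.measure_ball_pos _ _ one_pos).ne' measure_ball_lt_top.ne
  positivity

theorem cConst_pos {n k : ℕ} [NeZero n] (hk : 0 < k) (hkn : k ≤ n) : 0 < cConst n k := by
  have h1 := sphereArea_pos n
  have h2 : 0 < (n - 1).choose (k - 1) := Nat.choose_pos (by omega)
  have h3 : (0 : ℝ) < k := by exact_mod_cast hk
  unfold cConst
  positivity

/-! ### Integrability for each single function. -/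

theorem mul_sqrt_le_sq_div_four_add {K t : ℝ} (ht : 0 ≤ t) : K * √t ≤ K ^ 2 / 4 + t := by
  have := Real.sq_sqrt ht
  nlinarith [sq_nonneg (K / 2 - √t)]

theorem add_rpow_le_two_rpow_mul {x y q : ℝ} (hx : 0 ≤ x) (hy : 0 ≤ y) (hq : 1 ≤ q) :
    (x + y) ^ q ≤ 2 ^ (q - 1) * (x ^ q + y ^ q) := by
  lift x to NNReal using hx
  lift y to NNReal using hy
  exact_mod_cast NNReal.rpow_add_le_mul_rpow_add_rpow x y hq

/-- Functions of finite energy grow strictly slower than the extremal rate at the origin. -/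
theorem exists_rpow_abs_le {k : ℕ} (hk : 0 < k) {v : ℝ → ℝ}
    (hv : ∀ a b : ℝ, 0 < a → a ≤ b → b < 1 → AbsolutelyContinuousOnInterval v a b)
    (hlim : Tendsto v (𝓝[<] 1) (𝓝 0)) (hE : energy k v 0 1 ≠ ∞) :
    ∃ C : ℝ, ∀ r ∈ Ioo (0 : ℝ) 1, |v r| ^ (((k : ℝ) + 1) / k) ≤ C + loglog r / 2 := by
  have hk' : (0 : ℝ) < k := by exact_mod_cast hk
  set q : ℝ := ((k : ℝ) + 1) / k with hq
  have hq1 : 1 ≤ q := by rw [hq, le_div_iff₀ hk']; linarith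
  have hpw : ∀ {x u : ℝ}, 0 ≤ x → 0 ≤ u →
      (x ^ ((k : ℝ) / (k + 1)) * u ^ (1 / ((k : ℝ) + 1))) ^ q = x * u ^ (1 / (k : ℝ)) :=
    fun hx hu => by
      rw [Real.mul_rpow (by positivity) (by positivity), ← Real.rpow_mul hx, ← Real.rpow_mul hu,
        show (k : ℝ) / (k + 1) * q = 1 by rw [hq]; field_simp,
        show 1 / ((k : ℝ) + 1) * q = 1 / k by rw [hq]; field_simp, Real.rpow_one]
  set J := (energy k v 0 1).toReal with hJ
  have hbd : ∀ r ∈ Ioo (0 : ℝ) 1, |v r| ^ q ≤ loglog r * J ^ (1 / (k : ℝ)) := fun r hr => by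
    rw [← hpw (loglog_nonneg hr.1 hr.2.le) ENNReal.toReal_nonneg]
    refine Real.rpow_le_rpow (abs_nonneg _) (abs_le_of_tendsto_zero hk hr.1 hr.2 hv hlim
      ENNReal.toReal_nonneg ?_) (by positivity)
    rw [ENNReal.ofReal_toReal hE]
    exact lintegral_mono_set (Ioo_subset_Ioo_left hr.1.le)
  -- Chosen so that `2^(q-1) * η^(1/k) = 1/2`, where `2^(q-1)` is the convexity constant for `(x +
  -- y)^q`.
  set η : ℝ := (2 ^ (-q)) ^ (k : ℝ) with hη
  have hη0 : 0 < η := by positivity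
  have hηk : η ^ (1 / (k : ℝ)) = 2 ^ (-q) := by
    rw [hη, ← Real.rpow_mul (by positivity), mul_one_div_cancel hk'.ne', Real.rpow_one]
  -- Absolute continuity of the integral: the energy near the origin falls below `η`.
  obtain ⟨δ, hδ0, hδ⟩ := exists_pos_setLIntegral_lt_of_measure_lt (μ := volume.restrict (Ioo 0 1))
    hE (ENNReal.ofReal_pos.2 hη0).ne'
  obtain ⟨r₀, hr₀, hr₀1, hr₀δ⟩ : ∃ r₀ : ℝ, 0 < r₀ ∧ r₀ < 1 ∧ ENNReal.ofReal r₀ < δ := by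
    have hm : 0 < min δ 1 := lt_min hδ0 one_pos
    obtain ⟨x, hx0, hx⟩ := ENNReal.lt_iff_exists_real_btwn.1 hm
    refine ⟨x, by simpa using hx.1, ?_, hx.2.trans_le (min_le_left _ _)⟩
    have := hx.2.trans_le (min_le_right _ _)
    rwa [ENNReal.ofReal_lt_one] at this
  have hE0 : ∀ r, 0 ≤ r → energy k v r r₀ ≤ ENNReal.ofReal η := fun r hr => by
    refine le_trans ?_ (hδ (Ioo 0 r₀) ?_).le
    · rw [Measure.restrict_restrict measurableSet_Ioo,
        inter_eq_left.2 (Ioo_subset_Ioo_right hr₀1.le)]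
      exact lintegral_mono_set (Ioo_subset_Ioo_left hr)
    · rw [Measure.restrict_apply measurableSet_Ioo,
        inter_eq_left.2 (Ioo_subset_Ioo_right hr₀1.le), Real.volume_Ioo, sub_zero]
      exact hr₀δ
  refine ⟨loglog r₀ * J ^ (1 / (k : ℝ)) + 2 ^ (q - 1) * |v r₀| ^ q, fun r hr => ?_⟩
  have hl0 := loglog_nonneg hr₀ hr₀1.le
  have hlr := loglog_nonneg hr.1 hr.2.le
  have hJ0 : 0 ≤ J := ENNReal.toReal_nonneg
  rcases le_total r₀ r with h | h
  · have h1 : loglog r * J ^ (1 / (k : ℝ)) ≤ loglog r₀ * J ^ (1 / (k : ℝ)) := by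
      gcongr
      exact loglog_anti hr₀ h hr.2.le
    have h2 : 0 ≤ 2 ^ (q - 1) * |v r₀| ^ q := by positivity
    linarith [hbd r hr]
  · have h1 := abs_sub_le hk hr.1 h hr₀1.le (hv r r₀ hr.1 h hr₀1) hη0.le (hE0 r hr.1.le)
    have hs : 0 ≤ loglog r - loglog r₀ := sub_nonneg.2 (loglog_anti hr.1 h hr₀1.le)
    have h2 : |v r| ≤ |v r₀| + (loglog r - loglog r₀) ^ ((k : ℝ) / (k + 1)) *
        η ^ (1 / ((k : ℝ) + 1)) := by
      have := abs_add_le (v r - v r₀) (v r₀)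
      rw [sub_add_cancel] at this
      linarith
    calc
      |v r| ^ q ≤ (|v r₀| + (loglog r - loglog r₀) ^ ((k : ℝ) / (k + 1)) *
          η ^ (1 / ((k : ℝ) + 1))) ^ q := Real.rpow_le_rpow (abs_nonneg _) h2 (by positivity)
      _ ≤ 2 ^ (q - 1) * (|v r₀| ^ q + ((loglog r - loglog r₀) ^ ((k : ℝ) / (k + 1)) *
          η ^ (1 / ((k : ℝ) + 1))) ^ q) :=
        add_rpow_le_two_rpow_mul (abs_nonneg _) (by positivity) hq1
      _ = 2 ^ (q - 1) * |v r₀| ^ q + (loglog r - loglog r₀) / 2 := by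
        rw [hpw hs hη0.le, hηk, mul_add]
        congr 1
        rw [mul_left_comm, ← Real.rpow_add two_pos, show q - 1 + -q = -1 by ring, Real.rpow_neg_one]
        ring
      _ ≤ _ := by
        have : 0 ≤ loglog r₀ * J ^ (1 / (k : ℝ)) := by positivity
        linarith

theorem lintegral_exp_exp_lt_top {k : ℕ} (hk : 0 < k) [NeZero (2 * k)] {u : E (2 * k) → ℝ}
    (hu : u ∈ radialSobolev (2 * k) k (wOne (2 * k))) :
    ∫⁻ x in unitBall (2 * k),
      ENNReal.ofReal (Real.exp (Real.exp (|u x| ^ (((k : ℝ) + 1) / k)))) < ∞ := by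
  obtain ⟨hrad, hac, hlim, hfin⟩ := hu
  have hc := cConst_pos (n := 2 * k) hk (by omega)
  have hE : energy k (profile u) 0 1 ≠ ∞ := by
    intro h
    rw [wNorm_two_mul, h, ENNReal.mul_top (ENNReal.ofReal_pos.2 hc).ne',
      ENNReal.top_rpow_of_pos (by positivity)] at hfin
    exact lt_irrefl _ hfin
  obtain ⟨C, hC⟩ := exists_rpow_abs_le hk hac hlim hE
  have hΦ : Measurable fun y : ℝ =>
      ENNReal.ofReal (Real.exp (Real.exp (|y| ^ (((k : ℝ) + 1) / k)))) := by
    have := continuous_abs.measurable (α := ℝ)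
    fun_prop
  rw [lintegral_unitBall_comp hrad (continuousOn_of_locally_absolutelyContinuous hac) hΦ]
  refine ENNReal.mul_lt_top (measure_lt_top _ _) ?_
  set D : ℝ := Real.exp ((Real.exp C) ^ 2 / 4 + 1) with hD
  refine (setLIntegral_mono (g := fun _ => ENNReal.ofReal D) measurable_const ?_).trans_lt ?_
  · intro r hr
    rw [← ENNReal.ofReal_mul (pow_nonneg hr.1.le _)]
    apply ENNReal.ofReal_le_ofReal
    have hT := one_sub_log_pos hr.1 hr.2.le
    -- The left side is at most `e^C √T ≤ e^(2C)/4 + T`. Since `e^T = e/r`, the Jacobian `r^(2k-1) ≤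
    -- r` cancels the singularity.
    have h1 : Real.exp (|profile u r| ^ (((k : ℝ) + 1) / k)) ≤
        (Real.exp C) ^ 2 / 4 + (1 - Real.log r) := by
      refine le_trans ?_ (mul_sqrt_le_sq_div_four_add (by linarith))
      rw [← Real.exp_log (Real.sqrt_pos.2 (by linarith : 0 < 1 - Real.log r)),
        Real.log_sqrt (by linarith), ← Real.exp_add]
      exact Real.exp_le_exp.2 (hC r hr)
    calc
      r ^ (2 * k - 1) * Real.exp (Real.exp (|profile u r| ^ (((k : ℝ) + 1) / k)))
        ≤ r * Real.exp ((Real.exp C) ^ 2 / 4 + (1 - Real.log r)) := by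
          gcongr
          · exact hr.1.le
          · exact pow_le_of_le_one hr.1.le hr.2.le (by omega)
      _ = D := by
          rw [hD, ← add_sub_assoc, Real.exp_sub, Real.exp_log hr.1]
          field_simp [hr.1.ne']
  · rw [setLIntegral_const, Real.volume_Ioo]
    exact ENNReal.mul_lt_top ENNReal.ofReal_lt_top ENNReal.ofReal_lt_top


/-! ### Sublevel sets of the deficit of a normalized profile. -/

/-- `y r = c^{1/(k+1)} |v r|` normalizes a profile so that its energy is at most one. -/
noncomputable def normalized (k : ℕ) (c : ℝ) (v : ℝ → ℝ) (r : ℝ) : ℝ :=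
  c ^ (1 / ((k : ℝ) + 1)) * |v r|

section Normalized

variable {k : ℕ} {c : ℝ} {v : ℝ → ℝ}

theorem normalized_rpow (hk : 0 < k) (hc : 0 < c) (r : ℝ) :
    normalized k c v r ^ (((k : ℝ) + 1) / k) =
      c ^ (1 / (k : ℝ)) * |v r| ^ (((k : ℝ) + 1) / k) := by
  have hk' : (0 : ℝ) < k := by exact_mod_cast hk
  rw [normalized, Real.mul_rpow (by positivity) (abs_nonneg _), ← Real.rpow_mul hc.le]
  congr 2
  field_simp

theorem normalized_nonneg (hc : 0 < c) (r : ℝ) : 0 ≤ normalized k c v r := by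
  unfold normalized
  positivity

theorem normalized_le (hk : 0 < k) (hc : 0 < c)
    (hv : ∀ a b : ℝ, 0 < a → a ≤ b → b < 1 → AbsolutelyContinuousOnInterval v a b)
    (hlim : Tendsto v (𝓝[<] 1) (𝓝 0)) {r j : ℝ} (hr : r ∈ Ioo (0 : ℝ) 1) (hj : 0 ≤ j)
    (hE : ENNReal.ofReal c * energy k v r 1 ≤ ENNReal.ofReal j) :
    normalized k c v r ≤ loglog r ^ ((k : ℝ) / (k + 1)) * j ^ (1 / ((k : ℝ) + 1)) := by
  have h := abs_le_of_tendsto_zero hk hr.1 hr.2 hv hlim (J := j / c) (by positivity) (by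
    rw [ENNReal.ofReal_div_of_pos hc, ENNReal.le_div_iff_mul_le (by simp [hc]) (by simp), mul_comm]
    exact hE)
  calc
    normalized k c v r ≤ c ^ (1 / ((k : ℝ) + 1)) *
        (loglog r ^ ((k : ℝ) / (k + 1)) * (j / c) ^ (1 / ((k : ℝ) + 1))) := by
      unfold normalized
      gcongr
    _ = _ := by
      rw [mul_left_comm, ← Real.mul_rpow hc.le (by positivity), mul_div_cancel₀ _ hc.ne']

theorem normalized_le_add (hk : 0 < k) (hc : 0 < c)
    (hv : ∀ a b : ℝ, 0 < a → a ≤ b → b < 1 → AbsolutelyContinuousOnInterval v a b)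
    {a b j : ℝ} (ha : 0 < a) (hab : a ≤ b) (hb : b < 1) (hj : 0 ≤ j)
    (hE : ENNReal.ofReal c * energy k v a b ≤ ENNReal.ofReal j) :
    normalized k c v a ≤ normalized k c v b +
      (loglog a - loglog b) ^ ((k : ℝ) / (k + 1)) * j ^ (1 / ((k : ℝ) + 1)) := by
  have h := abs_sub_le hk ha hab hb.le (hv a b ha hab hb) (J := j / c) (by positivity) (by
    rw [ENNReal.ofReal_div_of_pos hc, ENNReal.le_div_iff_mul_le (by simp [hc]) (by simp), mul_comm]
    exact hE)
  have h2 : |v a| ≤ |v b| + |v a - v b| := by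
    have := abs_add_le (v a - v b) (v b)
    rw [sub_add_cancel] at this
    linarith
  calc
    normalized k c v a ≤ c ^ (1 / ((k : ℝ) + 1)) * (|v b| +
        (loglog a - loglog b) ^ ((k : ℝ) / (k + 1)) * (j / c) ^ (1 / ((k : ℝ) + 1))) := by
      unfold normalized
      gcongr
      linarith
    _ = _ := by
      rw [mul_add, mul_left_comm, ← Real.mul_rpow hc.le (by positivity), mul_div_cancel₀ _ hc.ne',
        normalized]

/-- The sublevel sets of the deficit `ln (e / r) - exp (y^{(k+1)/k})` at points where `ln (e / r)`
is large are short in the logarithmic scale. -/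
theorem deficit_sublevel_separation (hk : 0 < k) (hc : 0 < c)
    (hv : ∀ a b : ℝ, 0 < a → a ≤ b → b < 1 → AbsolutelyContinuousOnInterval v a b)
    (hlim : Tendsto v (𝓝[<] 1) (𝓝 0)) (hE : ENNReal.ofReal c * energy k v 0 1 ≤ 1)
    {a b l : ℝ} (ha : 0 < a) (hab : a ≤ b) (hb : b < 1) (hl : 1 ≤ l)
    (hlb : 8 * (1 + 2 ^ k) * l ≤ 1 - Real.log b)
    (hGb : 1 - Real.log b - Real.exp (normalized k c v b ^ (((k : ℝ) + 1) / k)) ≤ l)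
    (hGa : 1 - Real.log a - Real.exp (normalized k c v a ^ (((k : ℝ) + 1) / k)) ≤ l) :
    Real.log b - Real.log a ≤ 2 * (8 * (1 + 2 ^ k)) * l := by
  have hb0 := ha.trans_le hab
  have hadd : ENNReal.ofReal c * energy k v a b + ENNReal.ofReal c * energy k v b 1 ≤ 1 := by
    rw [← mul_add]
    refine le_trans ?_ hE
    gcongr
    refine (energy_add_energy_le k v).trans ?_
    rw [min_eq_left hab, max_eq_right hb.le]
    exact lintegral_mono_set (Ioo_subset_Ioo_left ha.le)
  -- The energy spent between `b` and the boundary; at most `1 - j` is left for `(a, b)`.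
  set j := (ENNReal.ofReal c * energy k v b 1).toReal with hj
  have hfin : ENNReal.ofReal c * energy k v b 1 ≠ ∞ :=
    ne_top_of_le_ne_top ENNReal.one_ne_top (le_add_self.trans hadd)
  have hj0 : 0 ≤ j := ENNReal.toReal_nonneg
  have hjE : ENNReal.ofReal j = ENNReal.ofReal c * energy k v b 1 := ENNReal.ofReal_toReal hfin
  have hj1 : j ≤ 1 := by
    rw [← ENNReal.ofReal_le_one, hjE]
    exact le_add_self.trans hadd
  have h1 := normalized_le hk hc hv hlim ⟨hb0, hb⟩ hj0 hjE.ge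
  have h2 := normalized_le_add hk hc hv ha hab hb (sub_nonneg.2 hj1) (by
    rw [ENNReal.ofReal_sub _ hj0, hjE, ENNReal.ofReal_one]
    exact ENNReal.le_sub_of_add_le_right hfin hadd)
  have := sublevel_separation hk (normalized_nonneg hc b) (normalized_nonneg hc a) hl hlb
    (by linarith [Real.log_le_log ha hab]) hj0 hj1 h1 h2 hGb hGa
  linarith

/-- If some point `b` of the sublevel set has large `1 - log b`, separation keeps every other such
point within a fixed logarithmic distance of it. The centre `r₀` is therefore a value of `log r`,
not a radius. -/
theorem exists_deficit_sublevel_subset (hk : 0 < k) (hc : 0 < c)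
    (hv : ∀ a b : ℝ, 0 < a → a ≤ b → b < 1 → AbsolutelyContinuousOnInterval v a b)
    (hlim : Tendsto v (𝓝[<] 1) (𝓝 0)) (hE : ENNReal.ofReal c * energy k v 0 1 ≤ 1)
    {l : ℝ} (hl : 1 ≤ l) :
    ∃ r₀ : ℝ, ∀ r ∈ Ioo (0 : ℝ) 1,
      1 - Real.log r - Real.exp (normalized k c v r ^ (((k : ℝ) + 1) / k)) ≤ l →
      Real.log r ∈ Icc (-(8 * (1 + 2 ^ k) * l)) 0 ∪
        Icc (r₀ - 2 * (8 * (1 + 2 ^ k)) * l) (r₀ + 2 * (8 * (1 + 2 ^ k)) * l) := by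
  by_cases h : ∃ b ∈ Ioo (0 : ℝ) 1,
      1 - Real.log b - Real.exp (normalized k c v b ^ (((k : ℝ) + 1) / k)) ≤ l ∧
        8 * (1 + 2 ^ k) * l ≤ 1 - Real.log b
  · obtain ⟨b, hb, hGb, hlb⟩ := h
    refine ⟨Real.log b, fun r hr hG => ?_⟩
    by_cases hlr : 8 * (1 + 2 ^ k) * l ≤ 1 - Real.log r
    · right
      rcases le_total r b with hrb | hrb
      · have := deficit_sublevel_separation hk hc hv hlim hE hr.1 hrb hb.2 hl hlb hGb hG
        have h2 := Real.log_le_log hr.1 hrb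
        constructor <;> linarith
      · have := deficit_sublevel_separation hk hc hv hlim hE hb.1 hrb hr.2 hl hlr hG hGb
        have h2 := Real.log_le_log hb.1 hrb
        constructor <;> linarith
    · left
      exact ⟨by linarith, Real.log_nonpos hr.1.le hr.2.le⟩
  · push Not at h
    refine ⟨0, fun r hr hG => Or.inl ?_⟩
    have := h r hr hG
    exact ⟨by linarith, Real.log_nonpos hr.1.le hr.2.le⟩

end Normalized

/-! ### The uniform bound at the critical exponent. -/

theorem lintegral_one_div_log_mem_Icc {x y : ℝ} (hxy : x ≤ y) :
    ∫⁻ r in Icc (Real.exp x) (Real.exp y), ENNReal.ofReal (1 / r) = ENNReal.ofReal (y - x) := by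
  have hle : Real.exp x ≤ Real.exp y := Real.exp_le_exp.2 hxy
  have hint : IntervalIntegrable (fun r : ℝ => 1 / r) volume (Real.exp x) (Real.exp y) := by
    apply ContinuousOn.intervalIntegrable
    rw [uIcc_of_le hle]
    exact continuousOn_const.div continuousOn_id
      fun r hr => ((Real.exp_pos x).trans_le hr.1).ne'
  rw [setLIntegral_congr Ioc_ae_eq_Icc.symm, ← ofReal_integral_eq_lintegral_ofReal hint.1
    ((ae_restrict_iff' measurableSet_Ioc).2 (.of_forall fun r hr =>
      (one_div_pos.2 ((Real.exp_pos x).trans hr.1)).le)), ← intervalIntegral.integral_of_le hle,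
    integral_one_div_of_pos (Real.exp_pos x) (Real.exp_pos y),
    Real.log_div (Real.exp_pos y).ne' (Real.exp_pos x).ne', Real.log_exp, Real.log_exp]

/-- The uniform bound for the critical radial integral. -/
noncomputable def criticalBound (k : ℕ) : ℝ≥0∞ :=
  ∑' m : ℕ, ENNReal.ofReal (Real.exp (2 * k) * Real.exp (-(2 * k * m))) *
    ENNReal.ofReal (5 * (8 * (1 + 2 ^ k)) * (m + 1))

theorem criticalBound_lt_top {k : ℕ} (hk : 0 < k) : criticalBound k < ∞ := by
  have hk' : (0 : ℝ) < k := by exact_mod_cast hk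
  have h0 : Summable fun m : ℕ => Real.exp (-(2 * k * m)) := by
    have := Real.summable_pow_mul_exp_neg_nat_mul 0 (r := 2 * k) (by positivity)
    refine this.congr fun m => ?_
    rw [pow_zero, one_mul]; congr 1; ring
  have h1 : Summable fun m : ℕ => (m : ℝ) * Real.exp (-(2 * k * m)) := by
    have := Real.summable_pow_mul_exp_neg_nat_mul 1 (r := 2 * k) (by positivity)
    refine this.congr fun m => ?_
    rw [pow_one]; congr 2; ring
  have h2 : Summable fun m : ℕ => Real.exp (2 * k) * Real.exp (-(2 * k * m)) *
      (5 * (8 * (1 + 2 ^ k)) * (m + 1)) := by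
    refine ((h1.add h0).mul_left (Real.exp (2 * k) * (5 * (8 * (1 + 2 ^ k))))).congr fun m => ?_
    ring
  unfold criticalBound
  simp_rw [← ENNReal.ofReal_mul (mul_nonneg (Real.exp_pos _).le (Real.exp_pos _).le)]
  rw [← ENNReal.ofReal_tsum_of_nonneg (fun m => by positivity) h2]
  exact ENNReal.ofReal_lt_top

/-- The integrand is `e^(2k) e^(-2kG) / r`. Slicing by `m = ⌊G⌋` bounds it on each slice by `e^(2k)
e^(-2km) / r`, and the slice lies in a set of logarithmic length linear in `m + 1`, so the series
converges. -/
theorem lintegral_radial_le_criticalBound {k : ℕ} {c : ℝ} {v : ℝ → ℝ} (hk : 0 < k) (hc : 0 < c)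
    (hv : ∀ a b : ℝ, 0 < a → a ≤ b → b < 1 → AbsolutelyContinuousOnInterval v a b)
    (hlim : Tendsto v (𝓝[<] 1) (𝓝 0)) (hE : ENNReal.ofReal c * energy k v 0 1 ≤ 1) :
    ∫⁻ r in Ioo (0 : ℝ) 1, ENNReal.ofReal (r ^ (2 * k - 1)) * ENNReal.ofReal (Real.exp (2 * k *
      Real.exp (c ^ (1 / (k : ℝ)) * |v r| ^ (((k : ℝ) + 1) / k)))) ≤ criticalBound k := by
  have hk' : (0 : ℝ) < k := by exact_mod_cast hk
  set M : ℝ := 8 * (1 + 2 ^ k) with hM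
  have hM0 : 0 < M := by positivity
  choose r₀ hr₀ using fun m : ℕ => exists_deficit_sublevel_subset hk hc hv hlim hE
    (l := m + 1) (by simp)
  simp only [← hM] at hr₀
  set A : ℕ → Set ℝ := fun m => Icc (Real.exp (-(M * (m + 1)))) (Real.exp 0) ∪
    Icc (Real.exp (r₀ m - 2 * M * (m + 1))) (Real.exp (r₀ m + 2 * M * (m + 1))) with hA
  have hAm : ∀ m, MeasurableSet (A m) := fun m => measurableSet_Icc.union measurableSet_Icc
  set w : ℕ → ℝ≥0∞ := fun m => ENNReal.ofReal (Real.exp (2 * k) * Real.exp (-(2 * k * m))) with hw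
  have hdiv : Measurable fun r : ℝ => ENNReal.ofReal (1 / r) :=
    (measurable_const.div measurable_id).ennreal_ofReal
  -- The interval ending at `1` contributes `M(m+1)` and the one centred at `r₀ m` contributes
  -- `4M(m+1)`.
  have hAint : ∀ m, ∫⁻ r in A m, ENNReal.ofReal (1 / r) ≤ ENNReal.ofReal (5 * M * (m + 1)) := by
    intro m
    refine (lintegral_union_le _ _ _).trans ?_
    have hm : (0 : ℝ) ≤ M * (m + 1) := by positivity
    rw [lintegral_one_div_log_mem_Icc (by linarith), lintegral_one_div_log_mem_Icc (by linarith),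
      ← ENNReal.ofReal_add (by linarith) (by linarith)]
    apply ENNReal.ofReal_le_ofReal
    linarith
  have hpt : ∀ r ∈ Ioo (0 : ℝ) 1, ENNReal.ofReal (r ^ (2 * k - 1)) * ENNReal.ofReal (Real.exp
      (2 * k * Real.exp (c ^ (1 / (k : ℝ)) * |v r| ^ (((k : ℝ) + 1) / k)))) ≤
      ∑' m, (A m).indicator (fun r => w m * ENNReal.ofReal (1 / r)) r := by
    intro r hr
    rw [← normalized_rpow hk hc]
    set X := Real.exp (normalized k c v r ^ (((k : ℝ) + 1) / k)) with hX
    -- Hölder from `r` to the boundary with total energy at most one gives `y^q ≤ loglog r`, that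
    -- is, a nonnegative deficit.
    have hG : 0 ≤ 1 - Real.log r - X := by
      have h1 := normalized_le hk hc hv hlim hr zero_le_one (by
        rw [ENNReal.ofReal_one]
        refine le_trans ?_ hE
        gcongr
        exact lintegral_mono_set (Ioo_subset_Ioo_left hr.1.le))
      have hl := loglog_nonneg hr.1 hr.2.le
      have h2 : normalized k c v r ^ (((k : ℝ) + 1) / k) ≤ loglog r := by
        calc
          _ ≤ (loglog r ^ ((k : ℝ) / (k + 1)) * 1 ^ (1 / ((k : ℝ) + 1))) ^ (((k : ℝ) + 1) / k) :=
            Real.rpow_le_rpow (normalized_nonneg hc r) h1 (by positivity)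
          _ = loglog r := by
            rw [Real.one_rpow, mul_one, ← Real.rpow_mul hl,
              show (k : ℝ) / (k + 1) * ((k + 1) / k) = 1 by field_simp, Real.rpow_one]
      rw [hX, ← exp_loglog hr.1 hr.2.le]
      linarith [Real.exp_le_exp.2 h2]
    set m := ⌊1 - Real.log r - X⌋₊ with hm
    have hm1 : (m : ℝ) ≤ 1 - Real.log r - X := Nat.floor_le hG
    have hm2 : 1 - Real.log r - X ≤ m + 1 := (Nat.lt_floor_add_one _).le
    have hrA : r ∈ A m := by
      have := hr₀ m r hr hm2
      rw [← Real.exp_log hr.1]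
      rcases this with h | h
      · exact Or.inl ⟨Real.exp_le_exp.2 h.1, Real.exp_le_exp.2 h.2⟩
      · exact Or.inr ⟨Real.exp_le_exp.2 h.1, Real.exp_le_exp.2 h.2⟩
    refine le_trans ?_ (ENNReal.le_tsum m)
    rw [indicator_of_mem hrA, hw, ← ENNReal.ofReal_mul (pow_nonneg hr.1.le _),
      ← ENNReal.ofReal_mul (by positivity)]
    apply ENNReal.ofReal_le_ofReal
    have hpow : r ^ (2 * k - 1) = Real.exp (2 * k * Real.log r) * (1 / r) := by
      rw [mul_comm (2 * (k : ℝ)), Real.exp_mul, Real.exp_log hr.1, show (2 * (k : ℝ)) = (2 * k : ℕ) by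
        push_cast; rfl, Real.rpow_natCast, mul_one_div, eq_div_iff hr.1.ne', ← pow_succ]
      congr 1
      omega
    rw [hpow, mul_right_comm, ← Real.exp_add, ← Real.exp_add]
    refine mul_le_mul_of_nonneg_right (Real.exp_le_exp.2 ?_) (one_div_pos.2 hr.1).le
    nlinarith
  calc
    _ ≤ ∫⁻ r in Ioo (0 : ℝ) 1, ∑' m, (A m).indicator (fun r => w m * ENNReal.ofReal (1 / r)) r :=
      setLIntegral_mono' measurableSet_Ioo hpt
    _ ≤ ∫⁻ r, ∑' m, (A m).indicator (fun r => w m * ENNReal.ofReal (1 / r)) r :=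
      setLIntegral_le_lintegral _ _
    _ = ∑' m, ∫⁻ r, (A m).indicator (fun r => w m * ENNReal.ofReal (1 / r)) r :=
      lintegral_tsum fun m => ((measurable_const.mul hdiv).indicator (hAm m)).aemeasurable
    _ ≤ criticalBound k := by
      unfold criticalBound
      refine ENNReal.tsum_le_tsum fun m => ?_
      rw [lintegral_indicator (hAm m), lintegral_const_mul _ hdiv]
      gcongr
      exact hAint m

theorem iSup_lintegral_lt_top {k : ℕ} (hk : 0 < k) [NeZero (2 * k)] {a : ℝ} (ha : a ≤ 2 * k) :
    (⨆ u ∈ {u | u ∈ PhiZeroRadW (2 * k) k (wOne (2 * k)) ∧ wNorm k (wOne (2 * k)) u ≤ 1},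
      ∫⁻ x in unitBall (2 * k), ENNReal.ofReal (Real.exp (a * Real.exp
        (cConst (2 * k) k ^ (1 / (k : ℝ)) * |u x| ^ (((k : ℝ) + 1) / k))))) < ∞ := by
  have hc := cConst_pos (n := 2 * k) hk (by omega)
  refine lt_of_le_of_lt (b := (volume : Measure (E (2 * k))).toSphere univ * criticalBound k)
    (iSup₂_le ?_) (ENNReal.mul_lt_top (measure_lt_top _ _) (criticalBound_lt_top hk))
  rintro u ⟨⟨⟨hrad, hac, hlim, -⟩, -⟩, hnorm⟩
  rw [wNorm_two_mul] at hnorm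
  have hE : ENNReal.ofReal (cConst (2 * k) k) * energy k (profile u) 0 1 ≤ 1 := by
    by_contra h
    exact absurd hnorm (not_le.2 (ENNReal.one_lt_rpow (not_le.1 h) (by positivity)))
  have hΦ : Measurable fun y : ℝ => ENNReal.ofReal (Real.exp (2 * k * Real.exp
      (cConst (2 * k) k ^ (1 / (k : ℝ)) * |y| ^ (((k : ℝ) + 1) / k)))) := by
    have := continuous_abs.measurable (α := ℝ)
    fun_prop
  calc
    _ ≤ ∫⁻ x in unitBall (2 * k), ENNReal.ofReal (Real.exp (2 * k * Real.exp
        (cConst (2 * k) k ^ (1 / (k : ℝ)) * |u x| ^ (((k : ℝ) + 1) / k)))) := by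
      gcongr
    _ ≤ _ := by
      rw [lintegral_unitBall_comp hrad (continuousOn_of_locally_absolutelyContinuous hac) hΦ]
      gcongr
      exact lintegral_radial_le_criticalBound hk hc hac hlim hE


/-! ### Principal minors of radial Hessians. -/

theorem card_filter_mem_powersetCard_succ {ι : Type*} [DecidableEq ι] (t : Finset ι) {i : ι}
    (hi : i ∈ t) (j : ℕ) :
    ((t.powersetCard (j + 1)).filter (i ∈ ·)).card = (t.card - 1).choose j := by
  have h : (t.powersetCard (j + 1)).filter (i ∈ ·) =
      ((t.erase i).powersetCard j).image (insert i) := by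
    ext s
    simp only [Finset.mem_filter, Finset.mem_powersetCard, Finset.mem_image]
    constructor
    · rintro ⟨⟨hst, hs⟩, his⟩
      exact ⟨s.erase i, ⟨Finset.erase_subset_erase _ hst, by
        rw [Finset.card_erase_of_mem his, hs]; rfl⟩, Finset.insert_erase his⟩
    · rintro ⟨s', ⟨hst, hs⟩, rfl⟩
      have hi' : i ∉ s' := fun h => (Finset.mem_erase.1 (hst h)).1 rfl
      exact ⟨⟨Finset.insert_subset hi (hst.trans (Finset.erase_subset _ _)), by
        rw [Finset.card_insert_of_notMem hi', hs]⟩, Finset.mem_insert_self _ _⟩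
  rw [h, Finset.card_image_of_injOn, Finset.card_powersetCard, Finset.card_erase_of_mem hi]
  intro s hs s' hs' hss
  simp only [Finset.mem_coe, Finset.mem_powersetCard] at hs hs'
  have h1 : i ∉ s := fun h => (Finset.mem_erase.1 (hs.1 h)).1 rfl
  have h2 : i ∉ s' := fun h => (Finset.mem_erase.1 (hs'.1 h)).1 rfl
  rw [← Finset.erase_insert h1, ← Finset.erase_insert h2]
  exact congrArg (fun z => Finset.erase z i) hss

theorem sum_powersetCard_succ_sum {ι : Type*} [DecidableEq ι] (t : Finset ι) (f : ι → ℝ) (j : ℕ) :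
    ∑ s ∈ t.powersetCard (j + 1), ∑ i ∈ s, f i = (t.card - 1).choose j * ∑ i ∈ t, f i := by
  have h : ∀ s ∈ t.powersetCard (j + 1), ∑ i ∈ s, f i = ∑ i ∈ t, if i ∈ s then f i else 0 := by
    intro s hs
    rw [← Finset.sum_filter, Finset.filter_mem_eq_inter,
      Finset.inter_eq_right.2 (Finset.mem_powersetCard.1 hs).1]
  rw [Finset.sum_congr rfl h, Finset.sum_comm, Finset.mul_sum]
  refine Finset.sum_congr rfl fun i hi => ?_
  rw [← Finset.sum_filter, Finset.sum_const, card_filter_mem_powersetCard_succ t hi, nsmul_eq_mul]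

/-- The matrix determinant lemma for a rank-one perturbation of `α • 1`; every principal submatrix
of a radial Hessian has this form. -/
theorem det_smul_one_add_rank_one {ι : Type*} [Fintype ι] [DecidableEq ι] {α β : ℝ} (hα : α ≠ 0)
    (x : ι → ℝ) :
    (Matrix.of fun i l => (if i = l then α else 0) + β * x i * x l).det =
      α ^ Fintype.card ι * (1 + β / α * ∑ i, x i ^ 2) := by
  have h : (Matrix.of fun i l => (if i = l then α else 0) + β * x i * x l) =
      α • (1 + Matrix.replicateCol Unit ((β / α) • x) * Matrix.replicateRow Unit x) := by
    ext i l
    simp only [Matrix.of_apply, Matrix.smul_apply, Matrix.add_apply, Matrix.one_apply,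
      Matrix.mul_apply, Matrix.replicateCol_apply, Matrix.replicateRow_apply, Pi.smul_apply,
      smul_eq_mul, Finset.univ_unique, Finset.sum_singleton]
    split_ifs
    · field_simp
    · field_simp
      ring
  rw [h, Matrix.det_smul, Matrix.det_one_add_replicateCol_mul_replicateRow]
  congr 2
  simp only [dotProduct, Pi.smul_apply, smul_eq_mul, Finset.mul_sum]
  exact Finset.sum_congr rfl fun i _ => by ring

theorem sumPrincipalMinors_rank_one {n : ℕ} (j : ℕ) {α β : ℝ} (hα : α ≠ 0) (x : Fin n → ℝ) :
    sumPrincipalMinors (j + 1) (Matrix.of fun i l => (if i = l then α else 0) + β * x i * x l) =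
      α ^ (j + 1) * (n.choose (j + 1) + β / α * ((n - 1).choose j * ∑ i, x i ^ 2)) := by
  unfold sumPrincipalMinors
  have h : ∀ s ∈ (Finset.univ : Finset (Fin n)).powersetCard (j + 1),
      ((Matrix.of fun i l => (if i = l then α else 0) + β * x i * x l).submatrix
        (Subtype.val : s → Fin n) (Subtype.val : s → Fin n)).det =
      α ^ (j + 1) * (1 + β / α * ∑ i ∈ s, x i ^ 2) := by
    intro s hs
    have h1 := det_smul_one_add_rank_one (ι := s) (β := β) hα fun i => x i
    rw [Fintype.card_coe, (Finset.mem_powersetCard.1 hs).2,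
      Finset.sum_coe_sort s fun i => x i ^ 2] at h1
    rw [← h1]
    congr 1
    ext i l
    simp only [Matrix.submatrix_apply, Matrix.of_apply, Subtype.ext_iff]
  rw [Finset.sum_congr rfl h, ← Finset.mul_sum, Finset.sum_add_distrib, ← Finset.mul_sum,
    sum_powersetCard_succ_sum]
  simp

/-- Because `n.choose j = (n/j) * (n-1).choose (j-1)` and `n/j ≥ 2`, the single condition `2α +
β|x|² ≥ 0` serves every order `j ≤ n/2`. -/
theorem sumPrincipalMinors_rank_one_nonneg {n j : ℕ} (hj : 1 ≤ j) (hjn : 2 * j ≤ n) {α β : ℝ}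
    (hα : 0 < α) (x : Fin n → ℝ) (h : 0 ≤ 2 * α + β * ∑ i, x i ^ 2) :
    0 ≤ sumPrincipalMinors j
      (Matrix.of fun i l => (if i = l then α else 0) + β * x i * x l) := by
  obtain ⟨j, rfl⟩ : ∃ i, j = i + 1 := ⟨j - 1, by omega⟩
  rw [sumPrincipalMinors_rank_one j hα.ne']
  refine mul_nonneg (by positivity) ?_
  have h1 : 2 * (n - 1).choose j ≤ n.choose (j + 1) := by
    obtain ⟨m, rfl⟩ : ∃ m, n = m + 1 := ⟨n - 1, by omega⟩
    have := Nat.add_one_mul_choose_eq m j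
    rw [Nat.add_sub_cancel]
    refine Nat.le_of_mul_le_mul_right ?_ (Nat.succ_pos j)
    rw [← Nat.succ_eq_add_one] at this ⊢
    calc 2 * m.choose j * j.succ = (2 * (j + 1)) * m.choose j := by rw [Nat.succ_eq_add_one]; ring
      _ ≤ (m + 1) * m.choose j := Nat.mul_le_mul_right _ hjn
      _ = _ := this
  have h2 : (2 : ℝ) * (n - 1).choose j ≤ n.choose (j + 1) := by exact_mod_cast h1
  have h3 : 0 ≤ 2 + β / α * ∑ i, x i ^ 2 := by
    have : 2 + β / α * ∑ i, x i ^ 2 = (2 * α + β * ∑ i, x i ^ 2) / α := by field_simp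
    rw [this]
    positivity
  have h4 : (0 : ℝ) ≤ (n - 1).choose j := by positivity
  nlinarith [mul_nonneg h4 h3]

/-- The Hessian of `x ↦ g (|x|²)`. -/
theorem hessian_comp_norm_sq {n : ℕ} {g g₁ : ℝ → ℝ} {g₂ : ℝ} {x : E n}
    (h₁ : ∀ᶠ ρ in 𝓝 (‖x‖ ^ 2), HasDerivAt g (g₁ ρ) ρ) (h₂ : HasDerivAt g₁ g₂ (‖x‖ ^ 2)) :
    hessian (fun y => g (‖y‖ ^ 2)) x =
      Matrix.of fun i l => (if i = l then 2 * g₁ (‖x‖ ^ 2) else 0) + 4 * g₂ * x i * x l := by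
  have hN : ∀ y : E n, HasFDerivAt (fun y : E n => ‖y‖ ^ 2) (2 • innerSL ℝ y) y :=
    fun y => (hasStrictFDerivAt_norm_sq y).hasFDerivAt
  have hcont : ContinuousAt (fun y : E n => ‖y‖ ^ 2) x := (hN x).continuousAt
  have hf : fderiv ℝ (fun y : E n => g (‖y‖ ^ 2)) =ᶠ[𝓝 x]
      fun y => (g₁ (‖y‖ ^ 2)) • ((2 : ℕ) • innerSL ℝ y) := by
    filter_upwards [hcont.eventually h₁] with y hy
    exact (hy.comp_hasFDerivAt y (hN y)).fderiv
  have hc : HasFDerivAt (fun y : E n => g₁ (‖y‖ ^ 2)) (g₂ • ((2 : ℕ) • innerSL ℝ x)) x :=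
    h₂.comp_hasFDerivAt x (hN x)
  have hi : HasFDerivAt (fun y : E n => (2 : ℕ) • innerSL ℝ y) ((2 : ℕ) • innerSL ℝ (E := E n)) x :=
    ((innerSL ℝ (E := E n)).hasFDerivAt).const_smul (2 : ℕ)
  have hs := hc.smul hi
  ext i l
  rw [hessian, Matrix.of_apply, hf.fderiv_eq]
  erw [hs.fderiv]
  simp only [add_apply, smul_apply,
    ContinuousLinearMap.smulRight_apply, Matrix.of_apply, innerSL_apply_apply]
  simp [EuclideanSpace.inner_single_right]
  erw [innerSL_apply_apply]
  rw [EuclideanSpace.inner_single_right]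
  by_cases hil : i = l
  · subst hil
    simp
    ring
  · simp [hil, Ne.symm hil]
    ring


/-! ### The test functions: admissibility and energy. -/

/-- `1 + ½ ln ((1 + δ) / (ρ + δ))`, a smooth version of `1 - ln r` at `ρ = r²`. -/
noncomputable def smoothLog (δ ρ : ℝ) : ℝ := 1 + (Real.log (1 + δ) - Real.log (ρ + δ)) / 2

/-- The regularized extremal profile in the variable `ρ = |x|²`. -/
noncomputable def moserProfile (c δ ρ : ℝ) : ℝ := -c * Real.log (smoothLog δ ρ)

/-- The regularized extremal function. -/
noncomputable def moserFunction (n : ℕ) (c δ : ℝ) (x : E n) : ℝ := moserProfile c δ (‖x‖ ^ 2)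

section Moser

variable {c δ ρ : ℝ}

theorem one_le_smoothLog (hδ : 0 < δ) (h0 : 0 ≤ ρ) (h1 : ρ ≤ 1) : 1 ≤ smoothLog δ ρ := by
  have := Real.log_le_log (by linarith : 0 < ρ + δ) (by linarith : ρ + δ ≤ 1 + δ)
  unfold smoothLog
  linarith

theorem hasDerivAt_smoothLog (h : 0 < ρ + δ) :
    HasDerivAt (smoothLog δ) (-(1 / (2 * (ρ + δ)))) ρ := by
  have h1 := ((((hasDerivAt_id ρ).add_const δ).log h.ne').const_sub (Real.log (1 + δ))).div_const 2
  have h2 := h1.const_add 1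
  convert! h2 using 1
  simp only [id]
  field_simp

theorem hasDerivAt_moserProfile (h : 0 < ρ + δ) (h' : 0 < smoothLog δ ρ) :
    HasDerivAt (moserProfile c δ) (c / (2 * ((ρ + δ) * smoothLog δ ρ))) ρ := by
  have h1 := ((hasDerivAt_smoothLog h).log h'.ne').const_mul (-c)
  convert! h1 using 1
  field_simp

theorem hasDerivAt_deriv_moserProfile (h : 0 < ρ + δ) (h' : 0 < smoothLog δ ρ) :
    HasDerivAt (fun ρ => c / (2 * ((ρ + δ) * smoothLog δ ρ)))
      (-(c * (2 * smoothLog δ ρ - 1)) / (4 * ((ρ + δ) * smoothLog δ ρ) ^ 2)) ρ := by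
  have h1 := (((hasDerivAt_id ρ).add_const δ).mul (hasDerivAt_smoothLog h)).const_mul 2
  have h2 := (hasDerivAt_const ρ c).div h1 (by simp only [Pi.mul_apply, id]; positivity)
  convert! h2 using 1
  simp only [Pi.mul_apply, id]
  field_simp
  ring

theorem contDiffOn_moserFunction (n : ℕ) (hδ : 0 < δ) :
    ContDiffOn ℝ 2 (moserFunction n c δ) (Metric.closedBall 0 1) := by
  intro x hx
  have hx1 : ‖x‖ ≤ 1 := by simpa using hx
  have h0 : 0 ≤ ‖x‖ ^ 2 := by positivity
  have h1 : ‖x‖ ^ 2 ≤ 1 := by nlinarith [norm_nonneg x]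
  have hs := one_le_smoothLog hδ h0 h1
  unfold moserFunction moserProfile smoothLog
  unfold smoothLog at hs
  have hn : ContDiffAt ℝ 2 (fun x : E n => ‖x‖ ^ 2) x := (contDiff_norm_sq ℝ).contDiffAt
  have := ((contDiffAt_const (c := 1)).add ((((contDiffAt_const (c := Real.log (1 + δ))).sub
    ((hn.add (contDiffAt_const (c := δ))).log (by positivity)))).div_const 2)).log
    (by linarith)
  exact ((contDiffAt_const (c := -c)).mul this).contDiffWithinAt

theorem moserFunction_mem_PhiZeroRad {n k : ℕ} [NeZero n] (hkn : 2 * k ≤ n) (hc : 0 < c)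
    (hδ : 0 < δ) : moserFunction n c δ ∈ PhiZeroRad n k := by
  have hC := contDiffOn_moserFunction (c := c) n hδ
  refine ⟨⟨⟨hC.mono Metric.ball_subset_closedBall, ?_, ?_⟩, ?_⟩, ?_⟩
  · exact hC.continuousOn.mono Metric.closure_ball_subset_closedBall
  · intro j hj x hx
    rw [Finset.mem_Icc] at hj
    have hx1 : ‖x‖ < 1 := by simpa [unitBall] using hx
    have h0 : 0 ≤ ‖x‖ ^ 2 := by positivity
    have h1 : ‖x‖ ^ 2 < 1 := by nlinarith [norm_nonneg x]
    have hL := one_le_smoothLog hδ h0 h1.le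
    have hP : 0 < ‖x‖ ^ 2 + δ := by positivity
    have hev : ∀ᶠ ρ in 𝓝 (‖x‖ ^ 2), HasDerivAt (moserProfile c δ)
        (c / (2 * ((ρ + δ) * smoothLog δ ρ))) ρ := by
      have e1 : ∀ᶠ ρ in 𝓝 (‖x‖ ^ 2), 0 < ρ + δ :=
        (continuous_id.add continuous_const).continuousAt.eventually (lt_mem_nhds hP)
      have e2 : ∀ᶠ ρ in 𝓝 (‖x‖ ^ 2), 0 < smoothLog δ ρ :=
        (hasDerivAt_smoothLog hP).continuousAt.eventually (lt_mem_nhds (by linarith))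
      filter_upwards [e1, e2] with ρ h h'
      exact hasDerivAt_moserProfile h h'
    have hH := hessian_comp_norm_sq hev (hasDerivAt_deriv_moserProfile (c := c) hP (by linarith))
    change 0 ≤ sumPrincipalMinors j (hessian (fun y => moserProfile c δ (‖y‖ ^ 2)) x)
    rw [hH]
    have hLp : 0 < smoothLog δ (‖x‖ ^ 2) := by linarith
    refine sumPrincipalMinors_rank_one_nonneg hj.1 (by omega) (by positivity) _ ?_
    rw [← EuclideanSpace.real_norm_sq_eq]
    set ρ := ‖x‖ ^ 2
    set L := smoothLog δ ρ
    -- This is `2α + β|x|²`. The constant `2` makes the terms `2ρL` cancel, leaving a nonnegative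
    -- numerator.
    have : 2 * (2 * (c / (2 * ((ρ + δ) * L)))) +
        4 * (-(c * (2 * L - 1)) / (4 * ((ρ + δ) * L) ^ 2)) * ρ =
        c * (2 * δ * L + ρ) / ((ρ + δ) * L) ^ 2 := by
      field_simp
      ring
    rw [this]
    positivity
  · intro x hx
    have hx1 : ‖x‖ = 1 := by
      rw [unitBall, frontier_ball _ one_ne_zero] at hx
      simpa using hx
    simp [moserFunction, moserProfile, smoothLog, hx1]
  · intro x _ y _ hxy
    simp [moserFunction, hxy]

theorem profile_moserFunction {n : ℕ} [NeZero n] :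
    profile (moserFunction n c δ) = fun r => moserProfile c δ (r ^ 2) := by
  ext r
  simp [profile, moserFunction, norm_smul]

theorem hasDerivAt_moserProfile_sq (hδ : 0 < δ) {r : ℝ} (h0 : 0 ≤ r) (h1 : r ≤ 1) :
    HasDerivAt (fun r => moserProfile c δ (r ^ 2))
      (c * (r / ((r ^ 2 + δ) * smoothLog δ (r ^ 2)))) r := by
  have hL := one_le_smoothLog hδ (sq_nonneg r) (pow_le_one₀ (n := 2) h0 h1)
  have h := (hasDerivAt_moserProfile (c := c) (δ := δ) (ρ := r ^ 2) (by positivity)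
    (by linarith)).comp r (hasDerivAt_pow 2 r)
  convert! h using 1
  field_simp
  ring

theorem continuousOn_smoothLog_sq (hδ : 0 < δ) :
    ContinuousOn (fun r : ℝ => smoothLog δ (r ^ 2)) (Icc 0 1) := fun r hr => by
  have h : ContinuousAt (smoothLog δ) (r ^ 2) :=
    (hasDerivAt_smoothLog (by positivity)).continuousAt
  exact (ContinuousAt.comp (f := fun r : ℝ => r ^ 2) h (continuous_pow 2).continuousAt)
    |>.continuousWithinAt

theorem continuousOn_deriv_moserProfile_sq (hδ : 0 < δ) :
    ContinuousOn (fun r : ℝ => c * (r / ((r ^ 2 + δ) * smoothLog δ (r ^ 2)))) (Icc 0 1) := by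
  refine continuousOn_const.mul (continuousOn_id.div
    ((by fun_prop : ContinuousOn (fun r : ℝ => r ^ 2 + δ) _).mul (continuousOn_smoothLog_sq hδ)) ?_)
  intro r hr
  have hL := one_le_smoothLog hδ (sq_nonneg r) (pow_le_one₀ (n := 2) hr.1 hr.2)
  have : 0 < smoothLog δ (r ^ 2) := by linarith
  positivity

/-- By `log x ≥ 1 - 1/x` at `x = r²/(r²+δ)`, replacing `log r` by its smooth version costs at most
`δ/2`; the extra term `δ * smoothLog ≥ δ` pays for it. -/
theorem sq_mul_one_sub_log_le (hδ : 0 < δ) {r : ℝ} (h0 : 0 < r) (h1 : r < 1) :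
    r ^ 2 * (1 - Real.log r) ≤ (r ^ 2 + δ) * smoothLog δ (r ^ 2) := by
  have hP : 0 < r ^ 2 + δ := by positivity
  have hr2 : 0 < r ^ 2 := by positivity
  have hq := Real.one_sub_inv_le_log_of_pos (div_pos hr2 hP)
  rw [Real.log_div hr2.ne' hP.ne', inv_div, Real.log_pow] at hq
  have h2 : Real.log (r ^ 2 + δ) ≤ Real.log (1 + δ) := Real.log_le_log hP (by nlinarith)
  have h3 : 0 ≤ Real.log (1 + δ) := Real.log_nonneg (by linarith)
  have h4 : r ^ 2 * ((1 - (r ^ 2 + δ) / r ^ 2)) ≤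
      r ^ 2 * (((2 : ℕ) : ℝ) * Real.log r - Real.log (r ^ 2 + δ)) := by gcongr
  have h5 : r ^ 2 * ((1 - (r ^ 2 + δ) / r ^ 2)) = -δ := by field_simp; ring
  rw [h5] at h4
  push_cast at h4
  unfold smoothLog
  nlinarith [mul_le_mul_of_nonneg_left h2 hδ.le, mul_nonneg hr2.le h3]

/-- The energy density is at most `c^k v'` with `v' ≥ 0`, so the bound is `c^k` times the total
increase of `v`. The leading constant must not be lost here, since it fixes the threshold for `a`.
-/
theorem energy_moserProfile_le (k : ℕ) (hc : 0 < c) (hδ : 0 < δ) :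
    energy k (fun r => moserProfile c δ (r ^ 2)) 0 1 ≤
      ENNReal.ofReal (c ^ (k + 1) * Real.log (smoothLog δ 0)) := by
  have hcont := continuousOn_deriv_moserProfile_sq (c := c) hδ
  have hint : IntervalIntegrable (fun r : ℝ => c * (r / ((r ^ 2 + δ) * smoothLog δ (r ^ 2))))
      volume 0 1 := ContinuousOn.intervalIntegrable (by rwa [uIcc_of_le zero_le_one])
  have hLpos : ∀ r ∈ Icc (0 : ℝ) 1, 0 < smoothLog δ (r ^ 2) := fun r hr => by
    linarith [one_le_smoothLog hδ (sq_nonneg r) (pow_le_one₀ (n := 2) hr.1 hr.2)]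
  have hint' := intervalIntegral.integral_eq_sub_of_hasDerivAt
    (f := fun r => moserProfile c δ (r ^ 2)) (fun r hr => by
      rw [uIcc_of_le zero_le_one] at hr
      exact hasDerivAt_moserProfile_sq hδ hr.1 hr.2) hint
  calc
    _ ≤ ∫⁻ r in Ioo (0 : ℝ) 1, ENNReal.ofReal (c ^ k) *
        ENNReal.ofReal (c * (r / ((r ^ 2 + δ) * smoothLog δ (r ^ 2)))) := by
      refine setLIntegral_mono' measurableSet_Ioo fun r hr => ?_
      have hL := hLpos r ⟨hr.1.le, hr.2.le⟩
      have hr0 := hr.1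
      have hT := one_sub_log_pos hr.1 hr.2.le
      rw [energyDensity, (hasDerivAt_moserProfile_sq hδ hr.1.le hr.2.le).deriv,
        ← ENNReal.ofReal_mul (by positivity), abs_of_nonneg (by positivity)]
      apply ENNReal.ofReal_le_ofReal
      set P := (r ^ 2 + δ) * smoothLog δ (r ^ 2) with hPdef
      have hP : 0 < P := by positivity
      have hle : r * (r / P) * (1 - Real.log r) ≤ 1 := by
        rw [mul_div_assoc', div_mul_eq_mul_div, div_le_one hP, ← sq]
        exact sq_mul_one_sub_log_le hδ hr.1 hr.2
      have hle' := pow_le_one₀ (n := k) (by positivity) hle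
      calc
        r ^ k * (c * (r / P)) ^ (k + 1) * (1 - Real.log r) ^ k =
          c ^ k * (c * (r / P)) * (r * (r / P) * (1 - Real.log r)) ^ k := by
            rw [mul_pow, mul_pow, mul_pow]
            ring
        _ ≤ c ^ k * (c * (r / P)) * 1 := by gcongr
        _ = _ := mul_one _
    _ = _ := by
      rw [lintegral_const_mul' _ _ ENNReal.ofReal_ne_top, restrict_Ioo_eq_restrict_Ioc,
        ← ofReal_integral_eq_lintegral_ofReal hint.1
        ((ae_restrict_iff' measurableSet_Ioc).2 (.of_forall fun r hr => by
          have := hLpos r ⟨hr.1.le, hr.2⟩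
          have := hr.1
          positivity)), ← intervalIntegral.integral_of_le zero_le_one, hint',
        ← ENNReal.ofReal_mul (by positivity)]
      congr 1
      simp [moserProfile, smoothLog]
      ring

theorem moserFunction_mem_radialSobolev {k : ℕ} [NeZero (2 * k)] (hc : 0 < c) (hδ : 0 < δ) :
    moserFunction (2 * k) c δ ∈ radialSobolev (2 * k) k (wOne (2 * k)) := by
  refine ⟨(moserFunction_mem_PhiZeroRad (k := k) le_rfl hc hδ).2, fun a b ha hab hb => ?_, ?_, ?_⟩
  · rw [profile_moserFunction]
    refine ContDiffOn.absolutelyContinuousOnInterval ?_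
    rw [uIcc_of_le hab]
    have hn := (contDiffOn_moserFunction (c := c) (2 * k) hδ).of_le
      (show (1 : WithTop ℕ∞) ≤ 2 by norm_num)
    have hlin : ContDiffOn ℝ 1 (fun r : ℝ => r • EuclideanSpace.single (0 : Fin (2 * k)) (1 : ℝ))
        (Icc a b) := (contDiff_id.smul contDiff_const).contDiffOn
    rw [← profile_moserFunction (n := 2 * k)]
    refine hn.comp hlin fun r hr => ?_
    rw [mem_closedBall_zero_iff, norm_smul]
    have : 0 ≤ r := ha.le.trans hr.1
    simpa [abs_of_nonneg this] using hr.2.trans hb.le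
  · rw [profile_moserFunction]
    have h := (hasDerivAt_moserProfile_sq (c := c) hδ zero_le_one le_rfl).continuousAt.tendsto
    have h1 : moserProfile c δ (1 ^ 2) = 0 := by simp [moserProfile, smoothLog]
    rw [h1] at h
    exact h.mono_left nhdsWithin_le_nhds
  · rw [wNorm_two_mul, profile_moserFunction]
    refine ENNReal.rpow_lt_top_of_nonneg (by positivity) (ENNReal.mul_ne_top ENNReal.ofReal_ne_top ?_)
    exact ne_top_of_le_ne_top ENNReal.ofReal_ne_top (energy_moserProfile_le k hc hδ)

theorem wNorm_zero (k : ℕ) [NeZero (2 * k)] :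
    wNorm k (wOne (2 * k)) (0 : E (2 * k) → ℝ) = 0 := by
  have h : profile (0 : E (2 * k) → ℝ) = fun _ => 0 := by
    ext r
    simp [profile]
  rw [wNorm_two_mul, h, energy]
  simp only [energyDensity, deriv_const]
  simp
  positivity

theorem moserFunction_mem_PhiZeroRadW {k : ℕ} [NeZero (2 * k)] (hc : 0 < c) (hδ : 0 < δ) :
    moserFunction (2 * k) c δ ∈ PhiZeroRadW (2 * k) k (wOne (2 * k)) := by
  have h := moserFunction_mem_radialSobolev (k := k) hc hδ
  -- The function is its own approximant.
  refine ⟨h, fun ε hε => ⟨_, moserFunction_mem_PhiZeroRad le_rfl hc hδ, h.2.2.2, ?_⟩⟩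
  rwa [sub_self, wNorm_zero]

end Moser


/-! ### Blow-up above the critical exponent. -/

/-- Bernoulli twice: in the exponent it yields `A (B/A)^q`, and applied to `(B/A)^q` it yields a
loss linear in `A - B`. -/
theorem sub_mul_le_exp_log_mul_rpow {A B q : ℝ} (hA : 1 < A) (hB : 1 ≤ B) (hq : 1 ≤ q) :
    A - q * (A - B) ≤ Real.exp (Real.log A * (Real.log B / Real.log A) ^ q) := by
  have hS : 0 < Real.log A := Real.log_pos hA
  have hB0 : 0 ≤ Real.log B := Real.log_nonneg hB
  have hApos : 0 < A := by linarith
  have hBpos : 0 < B := by linarith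
  have h1 : 1 + q * (Real.log B / Real.log A - 1) ≤ (Real.log B / Real.log A) ^ q := by
    have := one_add_mul_self_le_rpow_one_add (s := Real.log B / Real.log A - 1)
      (by have := div_nonneg hB0 hS.le; linarith) hq
    rwa [add_sub_cancel] at this
  have h2 : 1 + q * (B / A - 1) ≤ (B / A) ^ q := by
    have := one_add_mul_self_le_rpow_one_add (s := B / A - 1)
      (by have := div_nonneg hBpos.le hApos.le; linarith) hq
    rwa [add_sub_cancel] at this
  have h3 : Real.log A + q * (Real.log B - Real.log A) ≤
      Real.log A * (Real.log B / Real.log A) ^ q := by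
    calc
      _ = Real.log A * (1 + q * (Real.log B / Real.log A - 1)) := by field_simp
      _ ≤ _ := by gcongr
  calc
    A - q * (A - B) = A * (1 + q * (B / A - 1)) := by field_simp; ring
    _ ≤ A * (B / A) ^ q := by gcongr
    _ = Real.exp (Real.log A + q * (Real.log B - Real.log A)) := by
      rw [Real.exp_add, Real.exp_log hApos, Real.rpow_def_of_pos (by positivity),
        Real.log_div hBpos.ne' hApos.ne', mul_comm q]
    _ ≤ _ := Real.exp_le_exp.2 h3

/-- The amplitude for which the regularized extremal function has norm at most one. -/
noncomputable def moserAmplitude (k : ℕ) (C δ : ℝ) : ℝ :=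
  (1 / (C * Real.log (smoothLog δ 0))) ^ (1 / ((k : ℝ) + 1))

theorem one_lt_smoothLog_zero {δ : ℝ} (hδ : 0 < δ) : 1 < smoothLog δ 0 := by
  have := Real.log_lt_log hδ (by linarith : δ < 1 + δ)
  unfold smoothLog
  rw [zero_add]
  linarith

theorem wNorm_moserFunction_le_one {k : ℕ} (hk : 0 < k) [NeZero (2 * k)] {δ : ℝ} (hδ : 0 < δ) :
    wNorm k (wOne (2 * k)) (moserFunction (2 * k) (moserAmplitude k (cConst (2 * k) k) δ) δ) ≤ 1 := by
  have hC := cConst_pos (n := 2 * k) hk (by omega)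
  have hS := Real.log_pos (one_lt_smoothLog_zero hδ)
  have hc : 0 < moserAmplitude k (cConst (2 * k) k) δ := by
    unfold moserAmplitude
    positivity
  have hpow : moserAmplitude k (cConst (2 * k) k) δ ^ (k + 1) =
      1 / (cConst (2 * k) k * Real.log (smoothLog δ 0)) := by
    rw [moserAmplitude, ← Real.rpow_natCast, ← Real.rpow_mul (by positivity)]
    push_cast
    rw [one_div_mul_cancel (by positivity), Real.rpow_one]
  rw [wNorm_two_mul, profile_moserFunction]
  refine ENNReal.rpow_le_one ?_ (by positivity)
  calc
    _ ≤ ENNReal.ofReal (cConst (2 * k) k) * ENNReal.ofReal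
        (moserAmplitude k (cConst (2 * k) k) δ ^ (k + 1) * Real.log (smoothLog δ 0)) := by
      gcongr
      exact energy_moserProfile_le k hc hδ
    _ = 1 := by
      rw [hpow, ← ENNReal.ofReal_mul hC.le, ← ENNReal.ofReal_one]
      congr 1
      field_simp

/-- For `|x|² ≤ δ`, `smoothLog` lies within `(log 2)/2` of its central value, whatever `δ` is. The
double exponential therefore loses only a bounded factor on this ball. -/
theorem le_exp_moserFunction {k n : ℕ} (hk : 0 < k) {C δ : ℝ} (hC : 0 < C) (hδ : 0 < δ)
    (hδ1 : δ ≤ 1) {x : E n} (hx : ‖x‖ ^ 2 ≤ δ) :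
    smoothLog δ 0 - ((k : ℝ) + 1) / k * (Real.log 2 / 2) ≤
      Real.exp (C ^ (1 / (k : ℝ)) *
        |moserFunction n (moserAmplitude k C δ) δ x| ^ (((k : ℝ) + 1) / k)) := by
  have hk' : (0 : ℝ) < k := by exact_mod_cast hk
  have hA := one_lt_smoothLog_zero hδ
  have hS := Real.log_pos hA
  have hB := one_le_smoothLog hδ hδ.le hδ1
  have hBA : smoothLog δ 0 - smoothLog δ δ = Real.log 2 / 2 := by
    unfold smoothLog
    rw [zero_add, ← two_mul, Real.log_mul two_ne_zero hδ.ne']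
    ring
  have hBx : smoothLog δ δ ≤ smoothLog δ (‖x‖ ^ 2) := by
    have := Real.log_le_log (by positivity : 0 < ‖x‖ ^ 2 + δ) (add_le_add_left hx δ)
    unfold smoothLog
    linarith
  have hlogB := Real.log_nonneg hB
  have hlogx := Real.log_le_log (by linarith) hBx
  have key := sub_mul_le_exp_log_mul_rpow hA hB (q := ((k : ℝ) + 1) / k)
    (by rw [le_div_iff₀ hk']; linarith)
  rw [hBA] at key
  refine key.trans (Real.exp_le_exp.2 ?_)
  have hc : 0 < moserAmplitude k C δ := by
    unfold moserAmplitude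
    positivity
  set S := Real.log (smoothLog δ 0)
  set q : ℝ := ((k : ℝ) + 1) / k with hq
  -- Since `q = 1 + 1/k`, the constant `C` cancels; at the centre the exponent is exactly `S`.
  have hcq : C ^ (1 / (k : ℝ)) * moserAmplitude k C δ ^ q = S / S ^ q := by
    have hqk : q = 1 + 1 / k := by rw [hq]; field_simp
    have h1 : moserAmplitude k C δ ^ q = (1 / (C * S)) ^ (1 / (k : ℝ)) := by
      rw [moserAmplitude, ← Real.rpow_mul (by positivity)]
      congr 1
      rw [hq]
      field_simp
    rw [h1, ← Real.mul_rpow hC.le (by positivity), hqk, Real.rpow_add hS, Real.rpow_one,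
      show C * (1 / (C * S)) = S⁻¹ by field_simp, Real.inv_rpow hS.le]
    field_simp
  calc
    S * (Real.log (smoothLog δ δ) / S) ^ q
      ≤ S * (Real.log (smoothLog δ (‖x‖ ^ 2)) / S) ^ q := by
        gcongr
    _ = C ^ (1 / (k : ℝ)) *
        (moserAmplitude k C δ * Real.log (smoothLog δ (‖x‖ ^ 2))) ^ q := by
        rw [Real.div_rpow (hlogB.trans hlogx) hS.le,
          Real.mul_rpow hc.le (hlogB.trans hlogx), ← mul_assoc, hcq]
        ring
    _ = _ := by
        rw [moserFunction, moserProfile, abs_mul, abs_neg, abs_of_pos hc,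
          abs_of_nonneg (hlogB.trans hlogx)]

/-- With `δ = e^(-2t)`, the ball of radius `e^(-t)` alone suffices: its volume contributes
`e^(-2kt)` and the integrand at least `e^(at)` up to a constant factor. -/
theorem le_lintegral_moserFunction {k : ℕ} (hk : 0 < k) [NeZero (2 * k)] {a t : ℝ} (ha : 0 < a)
    (ht : 0 < t) :
    ENNReal.ofReal (Real.exp ((a - 2 * k) * t + a * (1 - ((k : ℝ) + 1) / k * (Real.log 2 / 2)))) *
        volume (unitBall (2 * k)) ≤
      ∫⁻ x in unitBall (2 * k), ENNReal.ofReal (Real.exp (a * Real.exp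
        (cConst (2 * k) k ^ (1 / (k : ℝ)) *
          |moserFunction (2 * k) (moserAmplitude k (cConst (2 * k) k) (Real.exp (-t) ^ 2))
            (Real.exp (-t) ^ 2) x| ^ (((k : ℝ) + 1) / k)))) := by
  have hC := cConst_pos (n := 2 * k) hk (by omega)
  set ε := Real.exp (-t) with hε
  have hε0 : 0 < ε := Real.exp_pos _
  have hε1 : ε < 1 := by
    rw [hε, Real.exp_lt_one_iff]
    linarith
  have hδ1 : ε ^ 2 ≤ 1 := pow_le_one₀ hε0.le hε1.le
  have hA : 1 + t ≤ smoothLog (ε ^ 2) 0 := by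
    have h1 : 0 ≤ Real.log (1 + ε ^ 2) := Real.log_nonneg (by nlinarith)
    have h2 : Real.log (ε ^ 2) = -2 * t := by
      rw [Real.log_pow, hε, Real.log_exp]
      push_cast
      ring
    unfold smoothLog
    rw [zero_add, h2]
    linarith
  set κ := ((k : ℝ) + 1) / k * (Real.log 2 / 2) with hκ
  have hvol : volume (Metric.ball (0 : E (2 * k)) ε) =
      ENNReal.ofReal (Real.exp (-(2 * k * t))) * volume (unitBall (2 * k)) := by
    rw [unitBall, Measure.addHaar_ball _ _ hε0.le, finrank_euclideanSpace_fin, hε,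
      ← Real.exp_nat_mul]
    congr 3
    push_cast
    ring
  calc
    _ = ∫⁻ _ in Metric.ball (0 : E (2 * k)) ε, ENNReal.ofReal (Real.exp (a * (1 + t - κ))) := by
      rw [setLIntegral_const, hvol, ← mul_assoc, ← ENNReal.ofReal_mul (Real.exp_pos _).le,
        ← Real.exp_add]
      congr 3
      ring
    _ ≤ ∫⁻ x in Metric.ball (0 : E (2 * k)) ε, ENNReal.ofReal (Real.exp (a * Real.exp
        (cConst (2 * k) k ^ (1 / (k : ℝ)) *
          |moserFunction (2 * k) (moserAmplitude k (cConst (2 * k) k) (ε ^ 2)) (ε ^ 2) x| ^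
            (((k : ℝ) + 1) / k)))) := by
      refine setLIntegral_mono' measurableSet_ball fun x hx => ?_
      have hx' : ‖x‖ < ε := by simpa using hx
      apply ENNReal.ofReal_le_ofReal
      rw [Real.exp_le_exp]
      refine mul_le_mul_of_nonneg_left (le_trans ?_ (le_exp_moserFunction hk hC (by positivity) hδ1
        (pow_le_pow_left₀ (norm_nonneg x) hx'.le 2))) ha.le
      rw [← hκ]
      linarith
    _ ≤ _ := lintegral_mono_set (Metric.ball_subset_ball hε1.le)

theorem iSup_lintegral_eq_top {k : ℕ} (hk : 0 < k) [NeZero (2 * k)] {a : ℝ} (ha : 2 * k < a) :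
    (⨆ u ∈ {u | u ∈ PhiZeroRadW (2 * k) k (wOne (2 * k)) ∧ wNorm k (wOne (2 * k)) u ≤ 1},
      ∫⁻ x in unitBall (2 * k), ENNReal.ofReal (Real.exp (a * Real.exp
        (cConst (2 * k) k ^ (1 / (k : ℝ)) * |u x| ^ (((k : ℝ) + 1) / k))))) = ∞ := by
  have hk' : (0 : ℝ) < k := by exact_mod_cast hk
  have ha0 : 0 < a := by linarith
  set κ := ((k : ℝ) + 1) / k * (Real.log 2 / 2) with hκ
  have hvol : volume (unitBall (2 * k)) ≠ 0 := (Metric.measure_ball_pos _ _ one_pos).ne'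
  have hlim : Tendsto (fun t : ℝ => ENNReal.ofReal (Real.exp ((a - 2 * k) * t + a * (1 - κ))) *
      volume (unitBall (2 * k))) atTop (𝓝 (∞ * volume (unitBall (2 * k)))) := by
    refine ENNReal.Tendsto.mul_const ?_ (Or.inl ENNReal.top_ne_zero)
    refine ENNReal.tendsto_ofReal_atTop.comp (Real.tendsto_exp_atTop.comp ?_)
    exact tendsto_atTop_add_const_right _ _ (tendsto_id.const_mul_atTop (by linarith))
  rw [ENNReal.top_mul hvol] at hlim
  refine top_unique (le_of_tendsto hlim ?_)
  filter_upwards [eventually_gt_atTop 0] with t ht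
  have hδ : 0 < Real.exp (-t) ^ 2 := by positivity
  have hc : 0 < moserAmplitude k (cConst (2 * k) k) (Real.exp (-t) ^ 2) := by
    have hC := cConst_pos (n := 2 * k) hk (by omega)
    have hS := Real.log_pos (one_lt_smoothLog_zero hδ)
    unfold moserAmplitude
    positivity
  refine (le_lintegral_moserFunction hk ha0 ht).trans ?_
  exact le_iSup₂_of_le _ ⟨moserFunction_mem_PhiZeroRadW hc hδ, wNorm_moserFunction_le_one hk hδ⟩
    le_rfl

end KHessian

theorem theorem3 (n k : ℕ) [NeZero n] (hnk : n = 2 * k) :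
    (∀ u ∈ KHessian.PhiZeroRadW n k (KHessian.wOne n),
      ∫⁻ x in KHessian.unitBall n,
        ENNReal.ofReal (Real.exp (Real.exp (|u x| ^ (((n : ℝ) + 2) / n)))) < ∞) ∧
    (∀ a : ℝ,
      (⨆ u ∈ {u | u ∈ KHessian.PhiZeroRadW n k (KHessian.wOne n) ∧
          KHessian.wNorm k (KHessian.wOne n) u ≤ 1},
        ∫⁻ x in KHessian.unitBall n,
          ENNReal.ofReal (Real.exp (a * Real.exp
            (KHessian.cConst n k ^ (2 / (n : ℝ)) * |u x| ^ (((n : ℝ) + 2) / n))))) < ∞ ↔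
      a ≤ n) := by
  subst hnk
  have hk : 0 < k := by
    have := NeZero.ne (2 * k)
    omega
  have hk' : (0 : ℝ) < k := by exact_mod_cast hk
  have e1 : (((2 * k : ℕ) : ℝ) + 2) / (2 * k : ℕ) = ((k : ℝ) + 1) / k := by
    push_cast
    field_simp
  have e2 : 2 / ((2 * k : ℕ) : ℝ) = 1 / k := by
    push_cast
    field_simp
  rw [e1, e2]
  refine ⟨fun u hu => KHessian.lintegral_exp_exp_lt_top hk hu.1, fun a => ⟨fun h => ?_, fun h => ?_⟩⟩
  · by_contra ha
    push_cast at ha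
    rw [KHessian.iSup_lintegral_eq_top hk (not_le.1 ha)] at h
    exact lt_irrefl _ h
  · push_cast at h
    exact KHessian.iSup_lintegral_lt_top hk h
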